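/- Let $N=n_1+n_2$ and write $x=(x_1,x_2)\in\mathbb R^N=\mathbb R^{n_1}\times\mathbb R^{n_2}$, with $|\cdot|$ the Euclidean norm and $(e_j)_{1\le j\le N}$ the standard basis. A singular kernel of fundamental type on $\mathbb R^d$ is a tempered distribution $K$ with $\widehat K\in L^\infty(\mathbb R^d)$ that coincides on $\mathbb R^d\setminus\{0\}$ with a $C^1$ function $k$ for which there are constants $C_0,C_1,A_1\ge 0$ such that $|k(x)|\le C_0|x|^{-d}$ and $|\nabla k(x)|\le C_1|x|^{-d-1}$ for all $x\ne0$, and $\bigl|\int_{R_1<|x|<R_2}k\,dx\bigr|\le A_1$ for all $0<R_1<R_2<\infty$. For a finite signed measure $g$ on $\mathbb R^d$ the singular integral $Rg$ with kernel $K$ is the tempered distribution $\langle Rg,\varphi\rangle=\int_{\mathbb R^d}\langle K,\varphi(x+\cdot)\rangle\,dg(x)$. Let $m\in\mathbb N$ and $1<q\le\infty$. For $1\le j\le N$ and $1\le k\le m$ let $R_{jk}$ be a singular integral operator with a kernel of fundamental type on $\mathbb R^{n_1}$, let $g_{jk}$ be a finite signed measure on $\mathbb R^{n_1}$, and let $\gamma_{jk}\in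 L^q(\mathbb R^{n_2})$. Let $f:\mathbb R^N\to\mathbb R$ be locally integrable with $$\partial_j f=\sum_{k=1}^m (R_{jk}g_{jk})(x_1)\,\gamma_{jk}(x_2)\qquad (j=1,\dots,N)$$ in the sense of distributions, where $\langle (R_{jk}g_{jk})\gamma_{jk},\varphi\rangle=\int_{\mathbb R^{n_2}}\gamma_{jk}(x_2)\,\langle R_{jk}g_{jk},\varphi(\cdot,x_2)\rangle\,dx_2$. Let $h^i\in C_c^\infty(\mathbb R^{n_i})$ be any real-valued functions with $\int h^i=1$ ($i=1,2$). For $\xi=(\xi_1,\xi_2)\in\mathbb S^{N-1}$ and $1\le j\le N$ put $$\Upsilon^{\xi,j}(w_1)=h^1\!\left(\tfrac{\xi_1}2-w_1\right)\{w_1\}^j,\qquad \bar\Upsilon^{\xi,j}(w_2)=h^2\!\left(\tfrac{\xi_2}2-w_2\right)\{w_2\}^j,$$ where $\{w_1\}^j=(w_1,0)\cdot e_j$, $\{w_2\}^j=1$ if $j\le n_1$, and $\{w_1\}^j=1$, $\{w_2\}^j=(0,w_2)\cdot e_j$ if $j>n_1$. For a distribution $u$ on $\mathbb R^N$ put $$M_{\{\Upsilon^{\xi,j}\otimes\bar\Upsilon^{\xi,j}\}}u(x)=\sup_{\xi\in\mathbb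 S^{N-1}}\ \sup_{\varepsilon>0}\ \Bigl|\Bigl\langle u,\ \tfrac1{\varepsilon^{N}}\,\Upsilon^{\xi,j}\bigl(\tfrac{x_1-\cdot_1}{\varepsilon}\bigr)\,\bar\Upsilon^{\xi,j}\bigl(\tfrac{x_2-\cdot_2}{\varepsilon}\bigr)\Bigr\rangle\Bigr|\in[0,\infty].$$ Then there exist a function $V:\mathbb R^N\to[0,\infty)$ and a Lebesgue-negligible set $\mathcal N\subset\mathbb R^N$ such that $$V(x)=\sum_{j=1}^N\sum_{k=1}^m M_{\{\Upsilon^{\xi,j}\otimes\bar\Upsilon^{\xi,j}\}}(\gamma_{jk}R_{jk}g_{jk})(x)\qquad\text{for every }x\in\mathbb R^N\setminus\mathcal N$$ (in particular the right-hand side is finite there), and $$|f(x)-f(y)|\le|x-y|\,\bigl(V(x)+V(y)\bigr)\qquad\text{for all }x,y\in\mathbb R^N\setminus\mathcal N.$$ -/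

import Mathlib

open MeasureTheory SchwartzMap FourierTransform Distributions
open scoped ENNReal NNReal ContDiff

noncomputable section

/-- The Euclidean space `ℝᵈ`. -/
abbrev Space (d : ℕ) : Type := EuclideanSpace ℝ (Fin d)

/-- `ℝᴺ = ℝ^{n₁} × ℝ^{n₂}`, `N = n₁ + n₂`, with its Euclidean norm and Lebesgue measure; the two
blocks of variables of `x` are `x.fst` and `x.snd`. -/
abbrev SplitSpace (n₁ n₂ : ℕ) : Type := WithLp 2 (Space n₁ × Space n₂)

/-! ### Singular integrals of fundamental type -/

/-- `K` is a singular kernel of fundamental type on `ℝᵈ`: a tempered distribution with bounded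
Fourier transform which, away from the origin, is given by a `C¹` function `k` satisfying the size,
gradient and cancellation bounds. (`k` determines `K` up to a multiple of the Dirac mass at `0`.) -/
structure IsSingularKernelOfFundamentalType {d : ℕ} (K : 𝓢'(Space d, ℂ)) : Prop where
  fourier_mem_Linfty : ∃ κ : Lp ℂ ∞ (volume : Measure (Space d)),
    𝓕 K = Lp.toTemperedDistribution κ
  exists_kernel_function : ∃ k : Space d → ℂ,
    (∀ φ : 𝓢(Space d, ℂ), HasCompactSupport φ → (0 : Space d) ∉ tsupport φ →
      K φ = ∫ x, k x * φ x) ∧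
    ContDiffOn ℝ 1 k {0}ᶜ ∧
    (∃ C₀ : ℝ, 0 ≤ C₀ ∧ ∀ x, x ≠ 0 → ‖k x‖ ≤ C₀ / ‖x‖ ^ d) ∧
    (∃ C₁ : ℝ, 0 ≤ C₁ ∧ ∀ x, x ≠ 0 → ‖fderiv ℝ k x‖ ≤ C₁ / ‖x‖ ^ (d + 1)) ∧
    (∃ A₁ : ℝ, 0 ≤ A₁ ∧ ∀ R₁ R₂ : ℝ, 0 < R₁ → R₁ < R₂ →
      ‖∫ x in {x : Space d | R₁ < ‖x‖ ∧ ‖x‖ < R₂}, k x‖ ≤ A₁)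

/-- The integral of a complex function against a finite signed measure. -/
def signedIntegral {d : ℕ} (g : SignedMeasure (Space d)) (F : Space d → ℂ) : ℂ :=
  (∫ x, F x ∂g.toJordanDecomposition.posPart) - ∫ x, F x ∂g.toJordanDecomposition.negPart

/-- The singular integral `R̃ φ = K̃ ∗ φ` with reflected kernel `K̃(z) = K(-z)`, on Schwartz
functions: `(K̃ ∗ φ)(x) = ⟨K, φ(x + ·)⟩`. -/
def reflectedSingularIntegral {d : ℕ} (K : 𝓢'(Space d, ℂ)) (φ : 𝓢(Space d, ℂ)) (x : Space d) : ℂ :=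
  K (SchwartzMap.compSubConstCLM ℂ (-x) φ)

/-- The tempered distribution `R g`, for a finite signed measure `g`, where `R` is the singular
integral operator with kernel `K`: `⟨R g, φ⟩ = ⟨g, R̃ φ⟩`. -/
def singularIntegralMeasure {d : ℕ} (K : 𝓢'(Space d, ℂ)) (g : SignedMeasure (Space d))
    (φ : 𝓢(Space d, ℂ)) : ℂ :=
  signedIntegral g (reflectedSingularIntegral K φ)

/-! ### Tensor product of a distribution in `x₁` and a function of `x₂` -/

/-- The slice `x₁ ↦ φ(x₁, x₂)` of a Schwartz function on `ℝ^{n₁} × ℝ^{n₂}`. -/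
def slice {n₁ n₂ : ℕ} (x₂ : Space n₂) (φ : 𝓢(SplitSpace n₁ n₂, ℂ)) : 𝓢(Space n₁, ℂ) :=
  SchwartzMap.compCLMOfAntilipschitz ℂ (K := 1)
    (g := fun x₁ : Space n₁ => (WithLp.toLp 2 (x₁, x₂) : SplitSpace n₁ n₂))
    (by
      have h : (fun x₁ : Space n₁ => (WithLp.toLp 2 (x₁, x₂) : SplitSpace n₁ n₂)) =
          fun x₁ => ((WithLp.prodContinuousLinearEquiv 2 ℝ (Space n₁) (Space n₂)).symm
            : (Space n₁ × Space n₂) →L[ℝ] SplitSpace n₁ n₂)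
              (ContinuousLinearMap.inl ℝ (Space n₁) (Space n₂) x₁) +
            WithLp.toLp 2 (0, x₂) := by
        funext x₁
        rw [WithLp.ext_iff]
        simp
      rw [h]
      fun_prop)
    (AntilipschitzWith.of_le_mul_dist fun a b => by
      simp [WithLp.prod_dist_eq_of_L2])
    φ

/-- The distribution `T(x₁) γ(x₂)` on `ℝ^{n₁} × ℝ^{n₂}`:
`⟨T ⊗ γ, φ⟩ = ∫ γ(x₂) ⟨T, φ(·, x₂)⟩ dx₂`. -/
def tensorDistribution {n₁ n₂ : ℕ} (T : 𝓢(Space n₁, ℂ) → ℂ) (γ : Space n₂ → ℝ)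
    (φ : 𝓢(SplitSpace n₁ n₂, ℂ)) : ℂ :=
  ∫ x₂, (γ x₂ : ℂ) * T (slice x₂ φ)

/-- The standard basis of `ℝ^{n₁} × ℝ^{n₂}`, indexed by `Fin n₁ ⊕ Fin n₂`. -/
def stdBasis {n₁ n₂ : ℕ} : Fin n₁ ⊕ Fin n₂ → SplitSpace n₁ n₂
  | Sum.inl i => WithLp.toLp 2 (EuclideanSpace.single i 1, 0)
  | Sum.inr i => WithLp.toLp 2 (0, EuclideanSpace.single i 1)

/-- `∂_j f = u` in the sense of distributions. -/
def HasDistribPartialDeriv {n₁ n₂ : ℕ} (f : SplitSpace n₁ n₂ → ℝ) (j : Fin n₁ ⊕ Fin n₂)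
    (u : 𝓢(SplitSpace n₁ n₂, ℂ) → ℂ) : Prop :=
  ∀ φ : 𝓢(SplitSpace n₁ n₂, ℂ), HasCompactSupport φ →
    -(∫ x, (f x : ℂ) * fderiv ℝ φ x (stdBasis j)) = u φ

/-! ### Smooth maximal functions -/

/-- The function `y ↦ ρ_ε(x - y)`, where `ρ_ε(z) = ε^{-N} ρ(z / ε)` and `N` is the dimension. -/
def dilateReflect {E : Type*} [NormedAddCommGroup E] [NormedSpace ℝ E]
    (ρ : 𝓢(E, ℂ)) (ε : {ε : ℝ // 0 < ε}) (x : E) : 𝓢(E, ℂ) :=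
  ((ε : ℝ) ^ Module.finrank ℝ E)⁻¹ •
    SchwartzMap.compCLMOfAntilipschitz ℂ (K := Real.toNNReal ε)
      (g := fun y : E => (ε : ℝ)⁻¹ • (x - y))
      (by fun_prop)
      (AntilipschitzWith.of_le_mul_dist fun a b => by
        have hε : (0 : ℝ) < ε := ε.2
        rw [dist_smul₀, Real.norm_of_nonneg (inv_nonneg.2 hε.le), dist_sub_left]
        rw [Real.coe_toNNReal _ hε.le, mul_inv_cancel_left₀ hε.ne'])
      ρ

/-- The smooth maximal function of the distribution `u` for the family `ρ`:
`sup_ν sup_{ε > 0} |(ρ^ν_ε ∗ u)(x)|`, with `(ρ^ν_ε ∗ u)(x) = ⟨u, ρ^ν_ε(x - ·)⟩`. -/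
def smoothMaximal {ι E : Type*} [NormedAddCommGroup E] [NormedSpace ℝ E]
    (ρ : ι → 𝓢(E, ℂ)) (u : 𝓢(E, ℂ) → ℂ) (x : E) : ℝ≥0∞ :=
  ⨆ ν : ι, ⨆ ε : {ε : ℝ // 0 < ε}, ‖u (dilateReflect (ρ ν) ε x)‖ₑ

lemma hasCompactSupport_tensor {n₁ n₂ : ℕ} (a : 𝓓((⊤ : TopologicalSpace.Opens (Space n₁)), ℝ))
    (b : 𝓓((⊤ : TopologicalSpace.Opens (Space n₂)), ℝ)) :
    HasCompactSupport fun x : SplitSpace n₁ n₂ => ((a x.fst * b x.snd : ℝ) : ℂ) := by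
  have hK : IsCompact ((WithLp.prodContinuousLinearEquiv 2 ℝ (Space n₁) (Space n₂)).symm ''
      (tsupport a ×ˢ tsupport b)) :=
    (a.hasCompactSupport.isCompact.prod b.hasCompactSupport.isCompact).image
      (ContinuousLinearEquiv.continuous _)
  refine HasCompactSupport.intro hK fun x hx => ?_
  by_contra hne
  apply hx
  have h : a x.fst ≠ 0 ∧ b x.snd ≠ 0 := by
    constructor <;> intro h0 <;> apply hne <;> simp [h0]
  exact ⟨(x.fst, x.snd), ⟨subset_tsupport _ h.1, subset_tsupport _ h.2⟩, by
    rw [WithLp.ext_iff]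
    rfl⟩

lemma contDiff_tensor {n₁ n₂ : ℕ} (a : 𝓓((⊤ : TopologicalSpace.Opens (Space n₁)), ℝ))
    (b : 𝓓((⊤ : TopologicalSpace.Opens (Space n₂)), ℝ)) :
    ContDiff ℝ ∞ fun x : SplitSpace n₁ n₂ => ((a x.fst * b x.snd : ℝ) : ℂ) := by
  have h1 : ContDiff ℝ ∞ fun x : SplitSpace n₁ n₂ => a x.fst :=
    a.contDiff.comp ((ContinuousLinearMap.fst ℝ (Space n₁) (Space n₂)).comp
      (WithLp.prodContinuousLinearEquiv 2 ℝ (Space n₁) (Space n₂) :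
        SplitSpace n₁ n₂ →L[ℝ] Space n₁ × Space n₂)).contDiff
  have h2 : ContDiff ℝ ∞ fun x : SplitSpace n₁ n₂ => b x.snd :=
    b.contDiff.comp ((ContinuousLinearMap.snd ℝ (Space n₁) (Space n₂)).comp
      (WithLp.prodContinuousLinearEquiv 2 ℝ (Space n₁) (Space n₂) :
        SplitSpace n₁ n₂ →L[ℝ] Space n₁ × Space n₂)).contDiff
  exact Complex.ofRealCLM.contDiff.comp (h1.mul h2)

/-- The tensor product `(a ⊗ b)(x₁, x₂) = a(x₁) b(x₂)` of two test functions. -/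
def tensorTest {n₁ n₂ : ℕ} (a : 𝓓((⊤ : TopologicalSpace.Opens (Space n₁)), ℝ))
    (b : 𝓓((⊤ : TopologicalSpace.Opens (Space n₂)), ℝ)) : 𝓢(SplitSpace n₁ n₂, ℂ) :=
  (hasCompactSupport_tensor a b).toSchwartzMap (contDiff_tensor a b)

/-- The tensor-product smooth maximal function `M_{a^ν ⊗ b^ν} u`. -/
def tensorMaximal {ι : Type*} {n₁ n₂ : ℕ}
    (a : ι → 𝓓((⊤ : TopologicalSpace.Opens (Space n₁)), ℝ))
    (b : ι → 𝓓((⊤ : TopologicalSpace.Opens (Space n₂)), ℝ))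
    (u : 𝓢(SplitSpace n₁ n₂, ℂ) → ℂ) (x : SplitSpace n₁ n₂) : ℝ≥0∞ :=
  smoothMaximal (fun ν => tensorTest (a ν) (b ν)) u x

/-! ### The two families of test functions and the function `V` -/

lemma contDiff_shiftedWeight {d : ℕ} (h : 𝓓((⊤ : TopologicalSpace.Opens (Space d)), ℝ))
    (c : Space d) (p : Space d → ℝ) (hp : ContDiff ℝ ∞ p) :
    ContDiff ℝ ((⊤ : ℕ∞) : WithTop ℕ∞) fun w => h (c - w) * p w :=
  (h.contDiff.comp (contDiff_const.sub contDiff_id)).mul hp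

lemma hasCompactSupport_shiftedWeight {d : ℕ}
    (h : 𝓓((⊤ : TopologicalSpace.Opens (Space d)), ℝ)) (c : Space d) (p : Space d → ℝ) :
    HasCompactSupport fun w => h (c - w) * p w :=
  (h.hasCompactSupport.comp_homeomorph (Homeomorph.subLeft c)).mul_right

/-- The test function `w ↦ h(c - w) p(w)`, for a test function `h` and a smooth function `p`. -/
def shiftedWeight {d : ℕ} (h : 𝓓((⊤ : TopologicalSpace.Opens (Space d)), ℝ)) (c : Space d)
    (p : Space d → ℝ) (hp : ContDiff ℝ ∞ p) : 𝓓((⊤ : TopologicalSpace.Opens (Space d)), ℝ) where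
  toFun w := h (c - w) * p w
  contDiff' := contDiff_shiftedWeight h c p hp
  hasCompactSupport' := hasCompactSupport_shiftedWeight h c p
  tsupport_subset' := fun _ _ => trivial

/-- `{w₁}^j`: the coordinate `w₁ · e_j` if `j ≤ n₁`, and `1` otherwise. -/
def coordOne {n₁ n₂ : ℕ} : Fin n₁ ⊕ Fin n₂ → Space n₁ → ℝ
  | Sum.inl i => fun w => w i
  | Sum.inr _ => fun _ => 1

/-- `{w₂}^j`: `1` if `j ≤ n₁`, and the coordinate `w₂ · e_j` otherwise. -/
def coordTwo {n₁ n₂ : ℕ} : Fin n₁ ⊕ Fin n₂ → Space n₂ → ℝ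
  | Sum.inl _ => fun _ => 1
  | Sum.inr i => fun w => w i

lemma contDiff_coordOne {n₁ n₂ : ℕ} (j : Fin n₁ ⊕ Fin n₂) : ContDiff ℝ ∞ (coordOne j) := by
  cases j with
  | inl i => exact (EuclideanSpace.proj (𝕜 := ℝ) i).contDiff
  | inr i => exact contDiff_const

lemma contDiff_coordTwo {n₁ n₂ : ℕ} (j : Fin n₁ ⊕ Fin n₂) : ContDiff ℝ ∞ (coordTwo j) := by
  cases j with
  | inl i => exact contDiff_const
  | inr i => exact (EuclideanSpace.proj (𝕜 := ℝ) i).contDiff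

/-- `Υ^{ξ,j}(w₁) = h₁(ξ₁/2 - w₁) {w₁}^j`. -/
def upsilonOne {n₁ n₂ : ℕ} (h₁ : 𝓓((⊤ : TopologicalSpace.Opens (Space n₁)), ℝ))
    (j : Fin n₁ ⊕ Fin n₂) (ξ : Metric.sphere (0 : SplitSpace n₁ n₂) 1) :
    𝓓((⊤ : TopologicalSpace.Opens (Space n₁)), ℝ) :=
  shiftedWeight h₁ ((1 / 2 : ℝ) • (ξ : SplitSpace n₁ n₂).fst) (coordOne j) (contDiff_coordOne j)

/-- `Ῡ^{ξ,j}(w₂) = h₂(ξ₂/2 - w₂) {w₂}^j`. -/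
def upsilonTwo {n₁ n₂ : ℕ} (h₂ : 𝓓((⊤ : TopologicalSpace.Opens (Space n₂)), ℝ))
    (j : Fin n₁ ⊕ Fin n₂) (ξ : Metric.sphere (0 : SplitSpace n₁ n₂) 1) :
    𝓓((⊤ : TopologicalSpace.Opens (Space n₂)), ℝ) :=
  shiftedWeight h₂ ((1 / 2 : ℝ) • (ξ : SplitSpace n₁ n₂).snd) (coordTwo j) (contDiff_coordTwo j)

/-- `𝒱(R, γ, g) = ∑_j ∑_k M_{Υ^{ξ,j} ⊗ Ῡ^{ξ,j}} (γ_{jk} R_{jk} g_{jk})`, the supremum in the maximal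
function running over `ξ` in the unit sphere of `ℝᴺ`. -/
def splitV {n₁ n₂ m : ℕ} (h₁ : 𝓓((⊤ : TopologicalSpace.Opens (Space n₁)), ℝ))
    (h₂ : 𝓓((⊤ : TopologicalSpace.Opens (Space n₂)), ℝ))
    (K : Fin n₁ ⊕ Fin n₂ → Fin m → 𝓢'(Space n₁, ℂ))
    (γ : Fin n₁ ⊕ Fin n₂ → Fin m → Space n₂ → ℝ)
    (g : Fin n₁ ⊕ Fin n₂ → Fin m → SignedMeasure (Space n₁)) (x : SplitSpace n₁ n₂) : ℝ≥0∞ :=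
  ∑ j, ∑ k, tensorMaximal (upsilonOne h₁ j) (upsilonTwo h₂ j)
    (tensorDistribution (singularIntegralMeasure (K j k) (g j k)) (γ j k)) x

end

/-! Put r = |x - y| and ξ = (x - y)/r. Mollify f at scale r with η(w) = h₁(ξ₁/2 - w₁) h₂(ξ₂/2 - w₂),
evaluated at w = (x - z)/r. Since ξ/2 - (x - z)/r = (z - (x + y)/2)/r, this average is centred at
the midpoint, and the same average arises from y with direction -ξ (`shiftedTensor_symm`). It
therefore suffices to bound its distance to f(x) by r V(x), and likewise at y.

Let F(s) be the mollification at scale s seen from x. At a Lebesgue point F(s) → f(x) as s → 0. The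
scale derivative of s^{-N} η((x - z)/s) is minus s^{-N-1} times div(wη) = Nη + w·∇η, so it is a
divergence in z of dilates of w_j η, which are exactly the functions Υ ⊗ Ῡ
(`sum_fderiv_tensorTest_upsilon`). Hence F'(s) only sees the distributions ∂_j f, |F'(s)| ≤ V(x),
and the mean value inequality concludes (`norm_integral_dilate_sub_le`).

What remains is that V is finite almost everywhere. On tensor products the pairing factors. The γ
factor is controlled by Lebesgue differentiation. The other factor needs the nontangential maximal
function of a singular integral of a finite measure μ (`ae_exists_norm_integral_kernel_le`), with
constants uniform in ε. On the set F where μ(B(x,r)) ≤ n r^d for all r, μ is replaced by a smeared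
measure, each mass being spread at a scale proportional to its distance to F. The smeared measure
has bounded density (`smear_closedBall_le`), so L² theory applies to it. The error at points of F is
bounded, through the regularity of the mollified kernel
(`IsSingularKernelOfFundamentalType.exists_regularity_bound`), by a Marcinkiewicz-type integral that
is finite almost everywhere by Fubini. The sets F exhaust almost every point as n grows. -/

open Filter Topology Metric

/-! ### The Fourier representation of a kernel with bounded symbol -/

/-- `K` is the inverse Fourier transform of the bounded function `κ`. -/
structure HasBoundedSymbol {d : ℕ} (K : 𝓢'(Space d, ℂ)) (κ : Space d → ℂ) (B : ℝ) : Prop where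
  aestronglyMeasurable : AEStronglyMeasurable κ volume
  ae_norm_le : ∀ᵐ s, ‖κ s‖ ≤ B
  apply_eq : ∀ φ : 𝓢(Space d, ℂ), K φ = ∫ s, 𝓕⁻ φ s * κ s

lemma exists_hasBoundedSymbol {d : ℕ} {K : 𝓢'(Space d, ℂ)}
    (h : ∃ κ : Lp ℂ ∞ (volume : Measure (Space d)), 𝓕 K = Lp.toTemperedDistribution κ) :
    ∃ κ B, 0 ≤ B ∧ HasBoundedSymbol K κ B := by
  obtain ⟨κ, hκ⟩ := h
  refine ⟨κ, ‖κ‖, norm_nonneg _, (Lp.memLp κ).1, ?_, fun φ => ?_⟩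
  · filter_upwards [ae_le_eLpNormEssSup (f := κ) (μ := volume)] with s hs
    rw [← eLpNorm_exponent_top] at hs
    rw [Lp.norm_def, ← toReal_enorm]
    exact ENNReal.toReal_mono (Lp.eLpNorm_ne_top κ) hs
  have := congrArg (fun T : 𝓢'(Space d, ℂ) => T (𝓕⁻ φ)) hκ
  simpa [TemperedDistribution.fourier_apply] using this

lemma fourierInv_compSubConst {d : ℕ} (φ : 𝓢(Space d, ℂ)) (a s : Space d) :
    𝓕⁻ (SchwartzMap.compSubConstCLM ℂ a φ) s =
      Complex.exp ((2 * Real.pi * inner ℝ a s : ℝ) * Complex.I) * 𝓕⁻ φ s := by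
  rw [fourierInv_coe, fourierInv_coe, Real.fourierInv_eq', Real.fourierInv_eq',
    ← integral_const_mul, ← integral_add_right_eq_self _ a]
  congr 1 with v
  simp only [SchwartzMap.compSubConstCLM_apply, add_sub_cancel_right, smul_eq_mul, inner_add_left]
  rw [← mul_assoc, ← Complex.exp_add]
  congr 2
  push_cast
  ring

lemma fourierInv_dilateReflect {d : ℕ} (ψ : 𝓢(Space d, ℂ)) (ε : {ε : ℝ // 0 < ε})
    (z s : Space d) :
    𝓕⁻ (dilateReflect ψ ε z) s =
      Complex.exp ((2 * Real.pi * inner ℝ z s : ℝ) * Complex.I) * 𝓕 ψ ((ε : ℝ) • s) := by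
  have hε : (0 : ℝ) < ε := ε.2
  rw [fourierInv_coe, fourier_coe, Real.fourierInv_eq', Real.fourier_eq',
    ← integral_const_mul, ← integral_sub_left_eq_self _ _ z]
  have h := Measure.integral_comp_inv_smul_of_nonneg (μ := (volume : Measure (Space d)))
    (fun v : Space d => Complex.exp ((2 * Real.pi * inner ℝ z s : ℝ) * Complex.I) *
      (Complex.exp ((-2 * Real.pi * inner ℝ v ((ε : ℝ) • s) : ℝ) * Complex.I) • ψ v)) hε.le
  have hd : ((ε : ℝ) ^ Module.finrank ℝ (Space d)) ≠ 0 := by positivity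
  rw [← inv_smul_eq_iff₀ hd, ← integral_smul] at h
  rw [← h]
  congr 1 with v
  simp only [dilateReflect, smul_apply, compCLMOfAntilipschitz_apply, Function.comp_apply,
    sub_sub_cancel, inner_sub_left, real_inner_smul_left, real_inner_smul_right]
  rw [smul_comm, smul_eq_mul, smul_eq_mul, ← mul_assoc, ← Complex.exp_add]
  congr 3
  rw [mul_inv_cancel_left₀ hε.ne']
  push_cast
  ring

lemma dilateReflect_apply {E : Type*} [NormedAddCommGroup E] [NormedSpace ℝ E]
    (ρ : 𝓢(E, ℂ)) (ε : {ε : ℝ // 0 < ε}) (x y : E) :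
    dilateReflect ρ ε x y =
      (((ε : ℝ) ^ Module.finrank ℝ E)⁻¹ : ℝ) • ρ ((ε : ℝ)⁻¹ • (x - y)) := rfl

lemma reflectedSingularIntegral_dilateReflect {d : ℕ} (K : 𝓢'(Space d, ℂ)) (ψ : 𝓢(Space d, ℂ))
    (ε : {ε : ℝ // 0 < ε}) (x y : Space d) :
    reflectedSingularIntegral K (dilateReflect ψ ε x) y = K (dilateReflect ψ ε (x - y)) := by
  unfold reflectedSingularIntegral
  congr 1
  ext v
  simp only [SchwartzMap.compSubConstCLM_apply, dilateReflect_apply]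
  congr 3
  abel

namespace HasBoundedSymbol

variable {d : ℕ} {K : 𝓢'(Space d, ℂ)} {κ : Space d → ℂ} {B : ℝ}

lemma integrable_mul (h : HasBoundedSymbol K κ B) {u : Space d → ℂ} (hu : Integrable u) :
    Integrable fun s => u s * κ s :=
  hu.mul_bdd h.aestronglyMeasurable h.ae_norm_le

lemma memLp_mul (h : HasBoundedSymbol K κ B) {u : Space d → ℂ} {p : ℝ≥0∞} (hu : MemLp u p) :
    MemLp (fun s => u s * κ s) p := by
  have hκ : MemLp κ ∞ volume := memLp_top_of_bound h.aestronglyMeasurable B h.ae_norm_le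
  exact hκ.mul' hu

/-- Translations become characters on the Fourier side. As a Fourier transform of an L¹ function,
the result is continuous and bounded, so it can be integrated against finite measures. -/
lemma reflectedSingularIntegral_eq (h : HasBoundedSymbol K κ B) (φ : 𝓢(Space d, ℂ))
    (y : Space d) :
    reflectedSingularIntegral K φ y = 𝓕 (fun s => 𝓕⁻ φ s * κ s) y := by
  rw [reflectedSingularIntegral, h.apply_eq, Real.fourier_eq']
  congr 1 with s
  rw [fourierInv_compSubConst, smul_eq_mul, mul_assoc, inner_neg_left, real_inner_comm]
  congr 3
  push_cast
  ring

lemma continuous_reflectedSingularIntegral (h : HasBoundedSymbol K κ B) (φ : 𝓢(Space d, ℂ)) :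
    Continuous (reflectedSingularIntegral K φ) := by
  rw [show reflectedSingularIntegral K φ = 𝓕 (fun s => 𝓕⁻ φ s * κ s) from
    funext (h.reflectedSingularIntegral_eq φ)]
  exact VectorFourier.fourierIntegral_continuous Real.continuous_fourierChar continuous_inner
    (h.integrable_mul (𝓕⁻ φ).integrable)

lemma exists_norm_reflectedSingularIntegral_le (h : HasBoundedSymbol K κ B)
    (φ : 𝓢(Space d, ℂ)) : ∃ C, ∀ y, ‖reflectedSingularIntegral K φ y‖ ≤ C := by
  refine ⟨∫ s, ‖𝓕⁻ φ s * κ s‖, fun y => ?_⟩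
  rw [h.reflectedSingularIntegral_eq]
  exact VectorFourier.norm_fourierIntegral_le_integral_norm ..

lemma apply_dilateReflect (h : HasBoundedSymbol K κ B) (ψ : 𝓢(Space d, ℂ))
    (ε : {ε : ℝ // 0 < ε}) (z : Space d) :
    K (dilateReflect ψ ε z) =
      ∫ s, Complex.exp ((2 * Real.pi * inner ℝ z s : ℝ) * Complex.I) *
        (𝓕 ψ ((ε : ℝ) • s) * κ s) := by
  rw [h.apply_eq]
  congr 1 with s
  rw [fourierInv_dilateReflect, mul_assoc]

/-- Two characters at frequency s differ by at most 2π|z - z'||s|, and rescaling the first moment of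
𝓕 ψ produces ε^{-(d+1)}. This covers points within a multiple of ε of the origin, where the kernel
function gives no information. -/
lemma norm_apply_dilateReflect_sub_le (hB : 0 ≤ B) (h : HasBoundedSymbol K κ B)
    (ψ : 𝓢(Space d, ℂ)) :
    ∃ C, 0 ≤ C ∧ ∀ (ε : {ε : ℝ // 0 < ε}) (z z' : Space d),
      ‖K (dilateReflect ψ ε z) - K (dilateReflect ψ ε z')‖ ≤ C * ‖z - z'‖ / (ε : ℝ) ^ (d + 1) := by
  refine ⟨2 * Real.pi * B * ∫ s, ‖s‖ * ‖𝓕 ψ s‖, by positivity, fun ε z z' => ?_⟩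
  have hε : (0 : ℝ) < ε := ε.2
  have hint : Integrable fun s : Space d => 𝓕 ψ ((ε : ℝ) • s) :=
    (𝓕 ψ).integrable.comp_smul hε.ne'
  have hexp : ∀ z : Space d, Integrable fun s : Space d =>
      Complex.exp ((2 * Real.pi * inner ℝ z s : ℝ) * Complex.I) *
        (𝓕 ψ ((ε : ℝ) • s) * κ s) := fun z => by
    refine (h.integrable_mul hint).bdd_mul (c := 1)
      (Continuous.aestronglyMeasurable (by fun_prop)) (Eventually.of_forall fun s => ?_)
    rw [Complex.norm_exp_ofReal_mul_I]
  rw [h.apply_dilateReflect, h.apply_dilateReflect, ← integral_sub (hexp z) (hexp z')]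
  have hmom : Integrable fun s : Space d => ‖(ε : ℝ) • s‖ * ‖𝓕 ψ ((ε : ℝ) • s)‖ := by
    have := (𝓕 ψ).integrable_pow_mul volume 1
    simp only [pow_one] at this
    exact this.comp_smul hε.ne'
  have hbound : ∀ᵐ s : Space d, ‖Complex.exp ((2 * Real.pi * inner ℝ z s : ℝ) * Complex.I) *
        (𝓕 ψ ((ε : ℝ) • s) * κ s) - Complex.exp ((2 * Real.pi * inner ℝ z' s : ℝ) * Complex.I) *
        (𝓕 ψ ((ε : ℝ) • s) * κ s)‖ ≤
      (2 * Real.pi * B * ‖z - z'‖ * (ε : ℝ)⁻¹) * (‖(ε : ℝ) • s‖ * ‖𝓕 ψ ((ε : ℝ) • s)‖) := by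
    filter_upwards [h.ae_norm_le] with s hs
    rw [← sub_mul, norm_mul, norm_mul]
    have h1 : ‖Complex.exp ((2 * Real.pi * inner ℝ z s : ℝ) * Complex.I) -
        Complex.exp ((2 * Real.pi * inner ℝ z' s : ℝ) * Complex.I)‖ ≤
        2 * Real.pi * (‖z - z'‖ * ‖s‖) := by
      have hfac : Complex.exp ((2 * Real.pi * inner ℝ z s : ℝ) * Complex.I) -
          Complex.exp ((2 * Real.pi * inner ℝ z' s : ℝ) * Complex.I) =
          Complex.exp ((2 * Real.pi * inner ℝ z' s : ℝ) * Complex.I) *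
          (Complex.exp (Complex.I * (2 * Real.pi * inner ℝ (z - z') s : ℝ)) - 1) := by
        rw [mul_sub, mul_one, ← Complex.exp_add]
        congr 2
        rw [inner_sub_left]
        push_cast
        ring
      rw [hfac, norm_mul, Complex.norm_exp_ofReal_mul_I, one_mul]
      refine Real.norm_exp_I_mul_ofReal_sub_one_le.trans ?_
      rw [norm_mul, Real.norm_of_nonneg (by positivity)]
      gcongr
      exact norm_inner_le_norm _ _
    rw [norm_smul, Real.norm_of_nonneg hε.le]
    calc _ ≤ 2 * Real.pi * (‖z - z'‖ * ‖s‖) * (‖𝓕 ψ ((ε : ℝ) • s)‖ * B) := by gcongr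
      _ = _ := by field_simp
  refine (norm_integral_le_of_norm_le (hmom.const_mul _) hbound).trans_eq ?_
  rw [integral_const_mul, Measure.integral_comp_smul_of_nonneg volume
    (fun s : Space d => ‖s‖ * ‖𝓕 ψ s‖) _ (hR := hε.le)]
  simp only [finrank_euclideanSpace, Fintype.card_fin, smul_eq_mul]
  field_simp
  ring

/-- The singular integral of a function of `L¹ ∩ L²` is a function of `L²`. -/
lemma exists_memLp_two_integral_eq (h : HasBoundedSymbol K κ B) {u : Space d → ℂ}
    (hu : Integrable u) (hu2 : MemLp u 2) :
    ∃ w : Space d → ℂ, MemLp w 2 ∧ ∀ φ : 𝓢(Space d, ℂ),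
      ∫ y, reflectedSingularIntegral K φ y * u y = ∫ y, φ y * w y := by
  set U : Lp ℂ 2 (volume : Measure (Space d)) := 𝓕 hu2.toLp with hU
  have hflip : ∀ {f : Space d → ℂ}, Integrable f →
      ∫ y, 𝓕 f y * u y = ∫ s, f s * 𝓕 u s := fun {f} hf => by
    have := VectorFourier.integral_fourierIntegral_smul_eq_flip (L := innerₗ (Space d))
      Real.continuous_fourierChar continuous_inner hf hu
    rw [flip_innerₗ] at this
    exact this
  -- The L¹ and L² Fourier transforms of u agree because both pair with a test function φ as u pairs
  -- with 𝓕 φ.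
  have hûU : ∀ᵐ s, 𝓕 u s = U s := by
    refine ae_eq_of_integral_contDiff_smul_eq ?_ ((Lp.memLp U).locallyIntegrable one_le_two)
      fun g hg hgc => ?_
    · exact (VectorFourier.fourierIntegral_continuous Real.continuous_fourierChar continuous_inner
        hu).locallyIntegrable
    · have hg₁ : HasCompactSupport (Complex.ofRealCLM ∘ g) := hgc.comp_left rfl
      have hg₂ : ContDiff ℝ ∞ (Complex.ofRealCLM ∘ g) := by fun_prop
      set φ := hg₁.toSchwartzMap hg₂ with hφ
      have e1 : ∫ s, φ s * 𝓕 u s = ∫ y, 𝓕 φ y * u y := by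
        rw [fourier_coe, hflip φ.integrable]
      have e2 : ∫ s, φ s * U s = ∫ y, 𝓕 φ y * u y := by
        have := congrArg (fun T : 𝓢'(Space d, ℂ) => T φ)
          (Lp.fourier_toTemperedDistribution_eq hu2.toLp)
        simp only [TemperedDistribution.fourier_apply, Lp.toTemperedDistribution_apply,
          smul_eq_mul] at this
        rw [← hU] at this
        rw [← this]
        refine integral_congr_ae ?_
        filter_upwards [hu2.coeFn_toLp] with y hy
        rw [hy]
      have := e1.trans e2.symm
      simpa [hφ] using this
  -- A bounded multiplier preserves L², and w is the inverse transform of the product.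
  have hW : MemLp (fun s => U s * κ s) 2 := h.memLp_mul (Lp.memLp U)
  refine ⟨(𝓕⁻ hW.toLp : Lp ℂ 2 (volume : Measure (Space d))), Lp.memLp _, fun φ => ?_⟩
  have key := congrArg (fun T : 𝓢'(Space d, ℂ) => T φ)
    (Lp.fourierInv_toTemperedDistribution_eq hW.toLp)
  simp only [TemperedDistribution.fourierInv_apply, Lp.toTemperedDistribution_apply,
    smul_eq_mul] at key
  rw [← key]
  simp only [h.reflectedSingularIntegral_eq]
  rw [hflip (h.integrable_mul (𝓕⁻ φ).integrable)]
  refine integral_congr_ae ?_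
  filter_upwards [hûU, hW.coeFn_toLp] with s h1 h2
  rw [h1, h2]
  ring

end HasBoundedSymbol

/-! ### Regularity of the mollified kernel -/

lemma integral_inv_pow_mul_norm_comp_inv_smul {d : ℕ} (u : Space d → ℂ)
    {ε : ℝ} (hε : 0 < ε) :
    ∫ v : Space d, (ε ^ d)⁻¹ * ‖u (ε⁻¹ • v)‖ = ∫ v, ‖u v‖ := by
  rw [integral_const_mul, Measure.integral_comp_inv_smul_of_nonneg volume (fun v => ‖u v‖) hε.le]
  simp only [finrank_euclideanSpace, Fintype.card_fin, smul_eq_mul]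
  field_simp

lemma tsupport_dilateReflect_subset {E : Type*} [NormedAddCommGroup E] [NormedSpace ℝ E]
    {ψ : 𝓢(E, ℂ)} {L : ℝ} (hL : ∀ v, ψ v ≠ 0 → ‖v‖ ≤ L) (ε : {ε : ℝ // 0 < ε}) (z : E) :
    tsupport (dilateReflect ψ ε z) ⊆ closedBall z (L * ε) := by
  have hε : (0 : ℝ) < ε := ε.2
  refine closure_minimal (fun w hw => ?_) isClosed_closedBall
  have h : ψ ((ε : ℝ)⁻¹ • (z - w)) ≠ 0 := fun h0 => hw (by simp [dilateReflect_apply, h0])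
  have := hL _ h
  rw [norm_smul, Real.norm_of_nonneg (inv_nonneg.2 hε.le), inv_mul_le_iff₀ hε] at this
  rw [mem_closedBall, dist_comm, dist_eq_norm]
  linarith

lemma exists_norm_le_of_hasCompactSupport {E F : Type*} [NormedAddCommGroup E]
    [NormedAddCommGroup F] {ψ : E → F} (h : HasCompactSupport ψ) :
    ∃ L, 0 ≤ L ∧ ∀ v, ψ v ≠ 0 → ‖v‖ ≤ L := by
  obtain ⟨L, hL⟩ := h.isCompact.isBounded.exists_norm_le
  exact ⟨max L 0, le_max_right _ _, fun v hv =>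
    (hL v (subset_tsupport _ hv)).trans (le_max_left _ _)⟩

/-- The ball is convex and stays at distance at least |a|/2 from the origin, so the mean value
inequality applies on it. -/
lemma norm_sub_le_of_fderiv_bound {d : ℕ} {k : Space d → ℂ} (hk : ContDiffOn ℝ 1 k {0}ᶜ)
    {C : ℝ} (hC : 0 ≤ C) (hbound : ∀ x, x ≠ 0 → ‖fderiv ℝ k x‖ ≤ C / ‖x‖ ^ (d + 1))
    {a x y : Space d} (ha : a ≠ 0) (hx : x ∈ closedBall a (‖a‖ / 2))
    (hy : y ∈ closedBall a (‖a‖ / 2)) :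
    ‖k y - k x‖ ≤ C * 2 ^ (d + 1) / ‖a‖ ^ (d + 1) * ‖y - x‖ := by
  have ha' : 0 < ‖a‖ := norm_pos_iff.2 ha
  have hfar : ∀ z ∈ closedBall a (‖a‖ / 2), ‖a‖ / 2 ≤ ‖z‖ := fun z hz => by
    rw [mem_closedBall, dist_eq_norm] at hz
    have := norm_sub_norm_le a z
    rw [norm_sub_rev] at this
    linarith
  have hne : ∀ z ∈ closedBall a (‖a‖ / 2), z ≠ 0 := fun z hz h0 => by
    have := hfar z hz
    rw [h0, norm_zero] at this
    linarith
  refine (convex_closedBall a (‖a‖ / 2)).norm_image_sub_le_of_norm_fderiv_le (𝕜 := ℝ)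
    (fun z hz => (hk.differentiableOn one_ne_zero).differentiableAt
      (isOpen_compl_singleton.mem_nhds (hne z hz))) (fun z hz => ?_) hx hy
  refine (hbound z (hne z hz)).trans ?_
  rw [mul_div_assoc, ← div_pow, div_eq_mul_inv, ← inv_pow]
  have := hfar z hz
  gcongr
  rw [← inv_div]
  gcongr

/-- A Hörmander-type smoothness estimate whose constant does not depend on ε. The extra point a',
within ε of a, is what yields nontangential rather than radial control. -/
lemma IsSingularKernelOfFundamentalType.exists_regularity_bound {d : ℕ} {K : 𝓢'(Space d, ℂ)}
    (hK : IsSingularKernelOfFundamentalType K) {ψ : 𝓢(Space d, ℂ)} (hψ : HasCompactSupport ψ) :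
    ∃ C, 0 ≤ C ∧ ∀ (ε : {ε : ℝ // 0 < ε}) (a a' b : Space d), a ≠ 0 → ‖a' - a‖ ≤ ε →
      ‖b‖ ≤ ‖a‖ / 4 →
      ‖K (dilateReflect ψ ε a') - K (dilateReflect ψ ε (a' - b))‖ ≤
        C * ‖b‖ / ‖a‖ ^ (d + 1) := by
  obtain ⟨κ, B, hB, hκ⟩ := exists_hasBoundedSymbol hK.fourier_mem_Linfty
  obtain ⟨C₀, hC₀, hlip⟩ := hκ.norm_apply_dilateReflect_sub_le hB ψ
  obtain ⟨k, hKk, hk, -, ⟨C₁, hC₁, hgrad⟩, -⟩ := hK.exists_kernel_function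
  obtain ⟨L, hL0, hL⟩ := exists_norm_le_of_hasCompactSupport hψ
  set I := ∫ v, ‖ψ v‖ with hI
  have hI0 : 0 ≤ I := by positivity
  refine ⟨C₀ * (8 * (L + 1)) ^ (d + 1) + C₁ * 2 ^ (d + 1) * I, by positivity,
    fun ε a a' b ha haa hb => ?_⟩
  have hε : (0 : ℝ) < ε := ε.2
  have ha' : 0 < ‖a‖ := norm_pos_iff.2 ha
  -- In the near regime ε^{-(d+1)} is at most a multiple of |a|^{-(d+1)} and the Fourier bound
  -- suffices. In the far regime the dilated supports miss the origin, so K acts through k;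
  -- displacements by a' - a and v total at most |a|/8, and adding b stays within |a|/2.
  rcases le_or_gt ‖a‖ (8 * (L + 1) * ε) with hle | hgt
  · refine (hlip ε a' (a' - b)).trans ?_
    rw [sub_sub_cancel]
    calc C₀ * ‖b‖ / (ε : ℝ) ^ (d + 1)
        = C₀ * (8 * (L + 1)) ^ (d + 1) * ‖b‖ / (8 * (L + 1) * ε) ^ (d + 1) := by
          rw [mul_pow _ (ε : ℝ), mul_right_comm, mul_comm _ ((ε : ℝ) ^ (d + 1)),
            mul_div_mul_right _ _ (by positivity)]
      _ ≤ C₀ * (8 * (L + 1)) ^ (d + 1) * ‖b‖ / ‖a‖ ^ (d + 1) := by gcongr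
      _ ≤ _ := by
          gcongr
          linarith [show 0 ≤ C₁ * 2 ^ (d + 1) * I by positivity]
  · have hrep : ∀ z : Space d, L * ε < ‖z‖ →
        Integrable (fun v : Space d => k (z - v) * ((((ε : ℝ) ^ d)⁻¹ : ℝ) • ψ ((ε : ℝ)⁻¹ • v))) ∧
        K (dilateReflect ψ ε z) =
          ∫ v : Space d, k (z - v) * ((((ε : ℝ) ^ d)⁻¹ : ℝ) • ψ ((ε : ℝ)⁻¹ • v)) := fun z hz => by
      have hts := tsupport_dilateReflect_subset hL ε z
      have h0 : (0 : Space d) ∉ tsupport (dilateReflect ψ ε z) := fun h => by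
        have := hts h
        rw [mem_closedBall, dist_zero_left] at this
        linarith
      have hcs : HasCompactSupport (dilateReflect ψ ε z) :=
        HasCompactSupport.of_support_subset_isCompact (isCompact_closedBall z (L * ε))
          ((subset_tsupport _).trans hts)
      have hcont : Continuous fun w => k w * dilateReflect ψ ε z w := by
        refine continuous_iff_continuousAt.2 fun w => ?_
        by_cases hw : w ∈ tsupport (dilateReflect ψ ε z)
        · have hw0 : w ≠ 0 := fun h => h0 (h ▸ hw)
          exact (hk.continuousOn.continuousAt (isOpen_compl_singleton.mem_nhds hw0)).mul
            (dilateReflect ψ ε z).continuous.continuousAt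
        · have : (fun w => k w * dilateReflect ψ ε z w) =ᶠ[𝓝 w] fun _ => 0 := by
            filter_upwards [(isClosed_tsupport _).isOpen_compl.mem_nhds hw] with v hv
            rw [image_eq_zero_of_notMem_tsupport hv, mul_zero]
          exact continuousAt_const.congr this.symm
      have hint := hcont.integrable_of_hasCompactSupport (μ := volume) hcs.mul_left
      have heq : ∀ v, k (z - v) * dilateReflect ψ ε z (z - v) =
          k (z - v) * ((((ε : ℝ) ^ d)⁻¹ : ℝ) • ψ ((ε : ℝ)⁻¹ • v)) := fun v => by
        rw [dilateReflect_apply, sub_sub_cancel, finrank_euclideanSpace, Fintype.card_fin]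
      refine ⟨(hint.comp_sub_left z).congr (Eventually.of_forall heq), ?_⟩
      rw [hKk _ hcs h0, ← integral_sub_left_eq_self _ _ z]
      exact integral_congr_ae (Eventually.of_forall heq)
    have hn1 : ‖a‖ - ε ≤ ‖a'‖ := by
      have := norm_sub_norm_le a a'
      rw [norm_sub_rev] at this
      linarith
    have hn2 : ‖a'‖ - ‖b‖ ≤ ‖a' - b‖ := norm_sub_norm_le a' b
    have hLε : 0 ≤ L * ε := by positivity
    obtain ⟨i1, e1⟩ := hrep a' (by nlinarith)
    obtain ⟨i2, e2⟩ := hrep (a' - b) (by nlinarith)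
    rw [e1, e2, ← integral_sub i1 i2]
    have hint : Integrable fun v : Space d => ((ε : ℝ) ^ d)⁻¹ * ‖ψ ((ε : ℝ)⁻¹ • v)‖ :=
      (ψ.integrable.comp_smul (inv_ne_zero hε.ne')).norm.const_mul _
    refine (norm_integral_le_of_norm_le
      (hint.const_mul (C₁ * 2 ^ (d + 1) / ‖a‖ ^ (d + 1) * ‖b‖))
      (Eventually.of_forall fun v => ?_)).trans ?_
    · rw [← sub_mul, norm_mul, norm_smul, Real.norm_of_nonneg (by positivity)]
      by_cases hv : ψ ((ε : ℝ)⁻¹ • v) = 0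
      · simp [hv]
      gcongr
      have hv' : ‖v‖ ≤ L * ε := by
        have := hL _ hv
        rw [norm_smul, Real.norm_of_nonneg (inv_nonneg.2 hε.le), inv_mul_le_iff₀ hε] at this
        linarith
      have hav : ‖a' - v - a‖ ≤ ‖a‖ / 8 := by
        calc ‖a' - v - a‖ = ‖(a' - a) - v‖ := by congr 1; abel
          _ ≤ ‖a' - a‖ + ‖v‖ := norm_sub_le _ _
          _ ≤ _ := by linarith
      have := norm_sub_le_of_fderiv_bound hk hC₁ hgrad ha (x := a' - b - v) (y := a' - v)
        (by
          rw [mem_closedBall, dist_eq_norm]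
          calc ‖a' - b - v - a‖ = ‖(a' - v - a) - b‖ := by congr 1; abel
            _ ≤ ‖a' - v - a‖ + ‖b‖ := norm_sub_le _ _
            _ ≤ _ := by linarith)
        (by
          rw [mem_closedBall, dist_eq_norm]
          linarith)
      rwa [show a' - v - (a' - b - v) = b by abel] at this
    · rw [integral_const_mul, integral_inv_pow_mul_norm_comp_inv_smul ψ hε, ← hI]
      rw [div_mul_eq_mul_div, div_mul_eq_mul_div, mul_right_comm]
      gcongr
      linarith [show 0 ≤ C₀ * (8 * (L + 1)) ^ (d + 1) by positivity]

/-! ### Pointwise growth of measures on balls -/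

/-- The `ν`-measure of balls centred at `x` is at most a multiple of their volume. -/
def HasBallGrowth {d : ℕ} (ν : Measure (Space d)) (x : Space d) : Prop :=
  ∃ C : ℝ≥0∞, C ≠ ⊤ ∧ ∀ r : ℝ, 0 < r → ν (closedBall x r) ≤ C * ENNReal.ofReal (r ^ d)

lemma volume_closedBall_eq {d : ℕ} (x : Space d) {r : ℝ} (hr : 0 ≤ r) :
    volume (closedBall x r) = ENNReal.ofReal (r ^ d) * volume (ball (0 : Space d) 1) := by
  rw [Measure.addHaar_closedBall _ _ hr, finrank_euclideanSpace, Fintype.card_fin]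

/-- Differentiation of measures handles radii below some δ depending on x, the hypothesis handles
radii at least 1, and monotonicity handles those in between. The final constant is the sum of the
three. -/
lemma ae_hasBallGrowth {d : ℕ} {ν : Measure (Space d)} {A : ℝ≥0∞} (hA : A ≠ ⊤)
    (h : ∀ x r, 1 ≤ r → ν (closedBall x r) ≤ A * ENNReal.ofReal (r ^ d)) :
    ∀ᵐ x, HasBallGrowth ν x := by
  have : IsLocallyFiniteMeasure ν := ⟨fun x => ⟨closedBall x 1, closedBall_mem_nhds x one_pos,
    (h x 1 le_rfl).trans_lt (by simpa using hA.lt_top)⟩⟩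
  filter_upwards [Besicovitch.ae_tendsto_rnDeriv ν volume, Measure.rnDeriv_lt_top ν volume]
    with x hx hfin
  set c := ν.rnDeriv volume x
  have hc : c < c + 1 := ENNReal.lt_add_right hfin.ne one_ne_zero
  obtain ⟨δ, hδ, hδc⟩ := mem_nhdsGT_iff_exists_Ioo_subset.1 (hx.eventually (gt_mem_nhds hc))
  rw [Set.mem_Ioi] at hδ
  set v := volume (ball (0 : Space d) 1) with hv
  have hvtop : v ≠ ⊤ := measure_ball_lt_top.ne
  refine ⟨(c + 1) * v + A + A * ENNReal.ofReal (δ⁻¹ ^ d), ?_, fun r hr => ?_⟩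
  · exact ENNReal.add_ne_top.2 ⟨ENNReal.add_ne_top.2 ⟨ENNReal.mul_ne_top
      (ENNReal.add_ne_top.2 ⟨hfin.ne, ENNReal.one_ne_top⟩) hvtop, hA⟩,
      ENNReal.mul_ne_top hA ENNReal.ofReal_ne_top⟩
  rw [add_mul, add_mul]
  rcases lt_or_ge r δ with h1 | h1
  · refine le_add_right (le_add_right ?_)
    have h2 : ν (closedBall x r) / volume (closedBall x r) ≤ c + 1 :=
      (show _ < _ from hδc ⟨hr, h1⟩).le
    rw [ENNReal.div_le_iff (measure_closedBall_pos volume x hr).ne'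
      measure_closedBall_lt_top.ne, volume_closedBall_eq x hr.le] at h2
    rwa [mul_assoc, mul_comm v]
  rcases le_total 1 r with h2 | h2
  · exact le_add_right (le_add_left (h x r h2))
  · refine le_add_left ?_
    calc ν (closedBall x r) ≤ ν (closedBall x 1) := measure_mono (closedBall_subset_closedBall h2)
      _ ≤ A := by simpa using h x 1 le_rfl
      _ ≤ A * ENNReal.ofReal (δ⁻¹ ^ d) * ENNReal.ofReal (r ^ d) := by
        rw [mul_assoc, ← ENNReal.ofReal_mul (by positivity), ← mul_pow]
        refine le_mul_of_one_le_right' ?_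
        rw [ENNReal.one_le_ofReal]
        refine one_le_pow₀ ?_
        rw [inv_mul_eq_div]
        exact (one_le_div hδ).2 h1

lemma ae_hasBallGrowth_of_isFiniteMeasure {d : ℕ} (ν : Measure (Space d)) [IsFiniteMeasure ν] :
    ∀ᵐ x, HasBallGrowth ν x :=
  ae_hasBallGrowth (measure_ne_top ν Set.univ) fun _ _ hr =>
    (measure_mono (Set.subset_univ _)).trans <| le_mul_of_one_le_right' <|
      ENNReal.one_le_ofReal.2 (one_le_pow₀ hr)

lemma ae_hasBallGrowth_of_memLp {d : ℕ} {F : Type*} [NormedAddCommGroup F] {w : Space d → F}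
    {p : ℝ≥0∞} (hp : 1 ≤ p) (hw : MemLp w p) :
    ∀ᵐ x, HasBallGrowth ((volume : Measure (Space d)).withDensity fun y => ‖w y‖ₑ) x := by
  set v := volume (ball (0 : Space d) 1) with hv
  have hvtop : v ≠ ⊤ := measure_ball_lt_top.ne
  refine ae_hasBallGrowth (A := eLpNorm w p volume * (1 + v)) (by have := hw.2; finiteness)
    fun x r hr => ?_
  have hr0 : (1 : ℝ≥0∞) ≤ ENNReal.ofReal (r ^ d) := ENNReal.one_le_ofReal.2 (one_le_pow₀ hr)
  rw [withDensity_apply _ measurableSet_closedBall, ← eLpNorm_one_eq_lintegral_enorm]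
  refine (eLpNorm_le_eLpNorm_mul_rpow_measure_univ hp hw.1.restrict).trans ?_
  rw [mul_assoc]
  refine mul_le_mul' (eLpNorm_mono_measure _ Measure.restrict_le_self) ?_
  rw [Measure.restrict_apply_univ, volume_closedBall_eq x (by linarith), ← hv, add_mul, one_mul,
    mul_comm v]
  have hexp : 1 / (1 : ℝ≥0∞).toReal - 1 / p.toReal ≤ 1 := by simp
  have hexp0 : 0 ≤ 1 / (1 : ℝ≥0∞).toReal - 1 / p.toReal := by
    rcases eq_or_ne p ⊤ with rfl | hp'
    · simp
    · have : 1 ≤ p.toReal := by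
        rw [← ENNReal.toReal_one]
        exact ENNReal.toReal_mono hp' hp
      simpa using inv_le_one_of_one_le₀ this
  -- Hölder leaves the volume to the power 1 - 1/p. Adding r^d makes the base at least 1, so the
  -- exponent can be raised to 1.
  calc (ENNReal.ofReal (r ^ d) * v) ^ (1 / (1 : ℝ≥0∞).toReal - 1 / p.toReal)
      ≤ (ENNReal.ofReal (r ^ d) + ENNReal.ofReal (r ^ d) * v) ^
          (1 / (1 : ℝ≥0∞).toReal - 1 / p.toReal) := ENNReal.rpow_le_rpow le_add_self hexp0
    _ ≤ (ENNReal.ofReal (r ^ d) + ENNReal.ofReal (r ^ d) * v) ^ (1 : ℝ) :=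
        ENNReal.rpow_le_rpow_of_exponent_le (le_add_right hr0) hexp
    _ = _ := ENNReal.rpow_one _

/-- Nontangential control of averages against dilates of a bounded compactly supported function. -/
lemma HasBallGrowth.exists_norm_integral_le {d : ℕ} {w : Space d → ℂ} {x : Space d}
    (h : HasBallGrowth ((volume : Measure (Space d)).withDensity fun y => ‖w y‖ₑ) x) {P L : ℝ}
    (hP : 0 ≤ P) (hL : 0 ≤ L) :
    ∃ C : ℝ, ∀ ε : ℝ, 0 < ε → ∀ ρ : Space d → ℂ, (∀ v, ‖ρ v‖ ≤ P) → (∀ v, ρ v ≠ 0 → ‖v‖ ≤ L) →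
      ∀ x', ‖x' - x‖ ≤ ε →
        ‖∫ y, (((ε ^ d)⁻¹ : ℝ) • ρ (ε⁻¹ • (x' - y))) * w y‖ ≤ C := by
  obtain ⟨C, hC, hg⟩ := h
  -- The dilate is at most ε^{-d} P and lives in the ball of radius (L + 1)ε about x, the extra ε
  -- coming from x' - x; the powers of ε cancel.
  refine ⟨(ENNReal.ofReal (P * (L + 1) ^ d) * C).toReal, fun ε hε ρ hρP hρL x' hx' => ?_⟩
  rw [← toReal_enorm]
  refine ENNReal.toReal_mono (by finiteness) ?_
  refine (enorm_integral_le_lintegral_enorm _).trans ?_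
  calc ∫⁻ y, ‖(((ε ^ d)⁻¹ : ℝ) • ρ (ε⁻¹ • (x' - y))) * w y‖ₑ
      ≤ ∫⁻ y, (closedBall x ((L + 1) * ε)).indicator
          (fun y => ENNReal.ofReal ((ε ^ d)⁻¹ * P) * ‖w y‖ₑ) y := by
        refine lintegral_mono fun y => ?_
        by_cases hy : ρ (ε⁻¹ • (x' - y)) = 0
        · simp [hy]
        · have hmem : y ∈ closedBall x ((L + 1) * ε) := by
            have := hρL _ hy
            rw [norm_smul, Real.norm_of_nonneg (inv_nonneg.2 hε.le), inv_mul_le_iff₀ hε] at this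
            rw [mem_closedBall, dist_eq_norm]
            calc ‖y - x‖ = ‖(x' - x) - (x' - y)‖ := by congr 1; abel
              _ ≤ ‖x' - x‖ + ‖x' - y‖ := norm_sub_le _ _
              _ ≤ _ := by linarith
          rw [Set.indicator_of_mem hmem, enorm_mul]
          gcongr
          rw [← ofReal_norm, norm_smul, Real.norm_of_nonneg (by positivity)]
          gcongr
          exact hρP _
    _ = ENNReal.ofReal ((ε ^ d)⁻¹ * P) *
          (volume.withDensity fun y => ‖w y‖ₑ) (closedBall x ((L + 1) * ε)) := by
        rw [lintegral_indicator measurableSet_closedBall,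
          lintegral_const_mul' _ _ ENNReal.ofReal_ne_top,
          withDensity_apply _ measurableSet_closedBall]
    _ ≤ ENNReal.ofReal ((ε ^ d)⁻¹ * P) * (C * ENNReal.ofReal (((L + 1) * ε) ^ d)) := by
        gcongr
        exact hg _ (by positivity)
    _ = ENNReal.ofReal (P * (L + 1) ^ d) * C := by
        rw [mul_comm C, ← mul_assoc, ← ENNReal.ofReal_mul (by positivity)]
        congr 2
        rw [mul_pow]
        field_simp

/-! ### Measures with bounded density -/

lemma le_smul_volume_of_ball_le {d : ℕ} {ν : Measure (Space d)} [IsFiniteMeasure ν] {A : ℝ≥0∞}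
    (hA : A ≠ ⊤)
    (h : ∀ x r, 0 < r → ν (closedBall x r) ≤ A * ENNReal.ofReal (r ^ d)) :
    ∃ c : ℝ≥0, ν ≤ c • volume := by
  set v := volume (ball (0 : Space d) 1) with hv
  have hvtop : v ≠ ⊤ := measure_ball_lt_top.ne
  have hv0 : v ≠ 0 := (measure_ball_pos _ _ one_pos).ne'
  refine ⟨(A / v).toNNReal, Measure.le_iff'.2 fun s => ?_⟩
  -- Absolute continuity of ν with respect to Lebesgue measure is not yet known, so the covering is
  -- taken for a measure that dominates ν.
  refine (Besicovitch.vitaliFamily (ν + volume)).measure_le_of_frequently_le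
    ((A / v).toNNReal • volume) ?_ s fun x _ => ?_
  · exact Measure.absolutelyContinuous_of_le (Measure.le_add_right le_rfl)
  · refine (Besicovitch.tendsto_filterAt (ν + volume) x).frequently (Eventually.frequently ?_)
    filter_upwards [self_mem_nhdsWithin] with r hr
    rw [Set.mem_Ioi] at hr
    refine (h x r hr).trans_eq ?_
    rw [Measure.smul_apply, volume_closedBall_eq x hr.le, ← hv, ENNReal.smul_def,
      ENNReal.coe_toNNReal (ENNReal.div_ne_top hA hv0), smul_eq_mul,
      mul_comm _ v, ← mul_assoc, ENNReal.div_mul_cancel hv0 hvtop]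

lemma exists_density_of_le_smul_volume {d : ℕ} {ν : Measure (Space d)} [IsFiniteMeasure ν]
    {c : ℝ≥0} (h : ν ≤ c • volume) :
    ∃ u : Space d → ℂ, Integrable u ∧ MemLp u 2 ∧
      ∀ Φ : Space d → ℂ, ∫ y, Φ y ∂ν = ∫ y, Φ y * u y := by
  have hac : ν ≪ volume := (Measure.absolutelyContinuous_of_le h).trans
    (Measure.smul_absolutelyContinuous)
  have hle : ν.rnDeriv volume ≤ᵐ[volume] fun _ => (c : ℝ≥0∞) := by
    refine ae_le_of_forall_setLIntegral_le_of_sigmaFinite (Measure.measurable_rnDeriv _ _)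
      fun s hs _ => ?_
    refine (Measure.setLIntegral_rnDeriv_le s).trans ?_
    rw [setLIntegral_const]
    exact h s
  have hint : Integrable fun y => ((ν.rnDeriv volume y).toReal : ℂ) :=
    (Measure.integrable_toReal_rnDeriv (μ := ν) (ν := volume)).ofReal
  have hbd : ∀ᵐ y, ‖((ν.rnDeriv volume y).toReal : ℂ)‖ ≤ c := by
    filter_upwards [hle] with y hy
    rw [Complex.norm_of_nonneg ENNReal.toReal_nonneg]
    exact ENNReal.toReal_mono ENNReal.coe_ne_top hy
  refine ⟨_, hint, ?_, fun Φ => ?_⟩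
  · rw [memLp_two_iff_integrable_sq_norm hint.1]
    simp only [pow_two]
    exact hint.norm.bdd_mul hint.1.norm (by simpa using hbd)
  · rw [← integral_rnDeriv_smul hac]
    congr 1 with y
    rw [Complex.real_smul, mul_comm]

/-- The density lies in L¹ ∩ L², so its singular integral is an L² function w, and the quantities to
bound are averages of w. -/
lemma ae_exists_norm_integral_kernel_le_of_le_smul_volume {d : ℕ} {K : 𝓢'(Space d, ℂ)}
    (hK : IsSingularKernelOfFundamentalType K) {ψ : 𝓢(Space d, ℂ)} (hψ : HasCompactSupport ψ)
    {ν : Measure (Space d)} [IsFiniteMeasure ν] {c : ℝ≥0} (hν : ν ≤ c • volume) :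
    ∀ᵐ x, ∃ C : ℝ, ∀ (ε : {ε : ℝ // 0 < ε}) (x' : Space d), ‖x' - x‖ ≤ ε →
      ‖∫ y, K (dilateReflect ψ ε (x' - y)) ∂ν‖ ≤ C := by
  obtain ⟨κ, B, hB, hκ⟩ := exists_hasBoundedSymbol hK.fourier_mem_Linfty
  obtain ⟨u, hu, hu2, hνu⟩ := exists_density_of_le_smul_volume hν
  obtain ⟨w, hw, hrep⟩ := hκ.exists_memLp_two_integral_eq hu hu2
  obtain ⟨L, hL0, hL⟩ := exists_norm_le_of_hasCompactSupport hψ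
  obtain ⟨P, hP⟩ := ψ.continuous.bounded_above_of_compact_support hψ
  filter_upwards [ae_hasBallGrowth_of_memLp one_le_two hw] with x hx
  obtain ⟨C, hC⟩ := hx.exists_norm_integral_le ((norm_nonneg _).trans (hP 0)) hL0
  refine ⟨C, fun ε x' hx' => ?_⟩
  simp only [← reflectedSingularIntegral_dilateReflect]
  rw [hνu, hrep]
  refine le_of_eq_of_le ?_ (hC ε ε.2 ψ hP hL x' hx')
  simp only [dilateReflect_apply, finrank_euclideanSpace, Fintype.card_fin]

/-! ### Smoothing a measure at the scale of the distance to a set -/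

/-- By translation and scaling the integral is the same for every y and every r > 0. -/
lemma exists_lintegral_div_pow_le (d : ℕ) : ∃ I : ℝ≥0∞, I ≠ ⊤ ∧ ∀ (r : ℝ) (y : Space d), 0 ≤ r →
    ∫⁻ x : Space d, ENNReal.ofReal (r / (r + ‖x - y‖) ^ (d + 1)) ≤ I := by
  have hint : Integrable fun x : Space d => ((1 + ‖x‖) ^ (d + 1))⁻¹ := by
    have h := integrable_one_add_norm (E := Space d) (μ := volume) (r := d + 1) (by simp)
    refine h.congr (Eventually.of_forall fun x => ?_)
    simp only
    rw [Real.rpow_neg (by positivity)]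
    norm_cast
  refine ⟨ENNReal.ofReal (∫ x : Space d, ((1 + ‖x‖) ^ (d + 1))⁻¹), ENNReal.ofReal_ne_top,
    fun r y hr => ?_⟩
  rcases hr.eq_or_lt with rfl | hr
  · simp
  have hpt : ∀ x : Space d, r / (r + ‖x‖) ^ (d + 1) =
      (r ^ d)⁻¹ * ((1 + ‖r⁻¹ • x‖) ^ (d + 1))⁻¹ := fun x => by
    rw [norm_smul, Real.norm_of_nonneg (inv_nonneg.2 hr.le)]
    rw [show r + ‖x‖ = r * (1 + r⁻¹ * ‖x‖) by field_simp, mul_pow]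
    field_simp
    ring
  rw [lintegral_sub_right_eq_self (fun x : Space d => ENNReal.ofReal (r / (r + ‖x‖) ^ (d + 1))) y]
  simp only [hpt]
  rw [← ofReal_integral_eq_lintegral_ofReal ((hint.comp_smul (inv_ne_zero hr.ne')).const_mul _)
    (Eventually.of_forall fun x => by positivity), integral_const_mul,
    Measure.integral_comp_inv_smul_of_nonneg volume
      (fun x : Space d => ((1 + ‖x‖) ^ (d + 1))⁻¹) hr.le,
    finrank_euclideanSpace, Fintype.card_fin, smul_eq_mul, inv_mul_cancel_left₀ (by positivity)]

/-- The uniform probability measure on the unit ball. -/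
noncomputable def unitBallMeasure (d : ℕ) : Measure (Space d) :=
  (volume (ball (0 : Space d) 1))⁻¹ • volume.restrict (ball 0 1)

instance isProbabilityMeasure_unitBallMeasure (d : ℕ) :
    IsProbabilityMeasure (unitBallMeasure d) := ⟨by
  rw [unitBallMeasure, Measure.smul_apply, Measure.restrict_apply_univ, smul_eq_mul,
    ENNReal.inv_mul_cancel (measure_ball_pos _ _ one_pos).ne' measure_ball_lt_top.ne]⟩

lemma unitBallMeasure_compl (d : ℕ) : unitBallMeasure d (ball 0 1)ᶜ = 0 := by
  rw [unitBallMeasure, Measure.smul_apply, Measure.restrict_apply measurableSet_ball.compl]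
  simp

lemma unitBallMeasure_closedBall_le {d : ℕ} (c : Space d) {s : ℝ} (hs : 0 ≤ s) :
    unitBallMeasure d (closedBall c s) ≤ ENNReal.ofReal (s ^ d) := by
  rw [unitBallMeasure, Measure.smul_apply, smul_eq_mul]
  refine (mul_le_mul_right (Measure.restrict_le_self _) _).trans_eq ?_
  rw [volume_closedBall_eq c hs, mul_left_comm,
    ENNReal.inv_mul_cancel (measure_ball_pos _ _ one_pos).ne' measure_ball_lt_top.ne, mul_one]

/-- A quarter of the distance to `F`. -/
noncomputable def smearRadius {d : ℕ} (F : Set (Space d)) (y : Space d) : ℝ := infDist y F / 4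

lemma smearRadius_nonneg {d : ℕ} (F : Set (Space d)) (y : Space d) : 0 ≤ smearRadius F y :=
  div_nonneg infDist_nonneg (by norm_num)

@[fun_prop]
lemma continuous_smearRadius {d : ℕ} (F : Set (Space d)) : Continuous (smearRadius F) :=
  (continuous_infDist_pt F).div_const 4

/-- Each point mass at `y` is spread uniformly over the ball of centre `y` and radius
`smearRadius F y`. -/
noncomputable def smear {d : ℕ} (F : Set (Space d)) (μ : Measure (Space d)) : Measure (Space d) :=
  (μ.prod (unitBallMeasure d)).map fun p => p.1 + smearRadius F p.1 • p.2

lemma measurable_smear_map {d : ℕ} (F : Set (Space d)) :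
    Measurable fun p : Space d × Space d => p.1 + smearRadius F p.1 • p.2 :=
  Continuous.measurable (by fun_prop)

instance isFiniteMeasure_smear {d : ℕ} (F : Set (Space d)) (μ : Measure (Space d))
    [IsFiniteMeasure μ] : IsFiniteMeasure (smear F μ) := by
  unfold smear
  infer_instance

/-- The growth bound is assumed only at centres in F, but smearing extends it to all centres. A ball
large compared with its distance D to F is compared with a ball centred in F; a small one receives
only a fraction of order (ρ/D)^d of each nearby mass. -/
lemma smear_closedBall_le {d : ℕ} {F : Set (Space d)} (hF : F.Nonempty) {μ : Measure (Space d)}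
    [IsFiniteMeasure μ] {A : ℝ≥0∞}
    (h : ∀ x ∈ F, ∀ r, 0 < r → μ (closedBall x r) ≤ A * ENNReal.ofReal (r ^ d))
    (z : Space d) {ρ : ℝ} (hρ : 0 < ρ) :
    smear F μ (closedBall z ρ) ≤ A * ENNReal.ofReal (20 ^ d) * ENNReal.ofReal (ρ ^ d) := by
  set D := infDist z F with hD
  have hD0 : 0 ≤ D := infDist_nonneg
  rw [smear, Measure.map_apply (measurable_smear_map F) measurableSet_closedBall,
    Measure.prod_apply (measurable_smear_map F measurableSet_closedBall)]
  -- A mass at y reaches the ball only if dist y z ≤ ρ + (D + dist y z)/4. The threshold is at most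
  -- 4ρ when D ≤ 8ρ and at most D/2 otherwise.
  have hfar : ∀ y : Space d, (4 * ρ + D) / 3 < dist y z →
      unitBallMeasure d (Prod.mk y ⁻¹' ((fun p : Space d × Space d =>
        p.1 + smearRadius F p.1 • p.2) ⁻¹' closedBall z ρ)) = 0 := fun y hy => by
    refine measure_mono_null (t := (ball 0 1)ᶜ) (fun v hv hv1 => ?_) (unitBallMeasure_compl d)
    simp only [Set.mem_preimage, mem_closedBall, dist_eq_norm] at hv
    rw [mem_ball_zero_iff] at hv1
    have h1 : infDist y F ≤ D + dist y z := infDist_le_infDist_add_dist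
    have h2 : ‖smearRadius F y • v‖ ≤ smearRadius F y := by
      rw [norm_smul, Real.norm_of_nonneg (smearRadius_nonneg F y)]
      exact mul_le_of_le_one_right (smearRadius_nonneg F y) hv1.le
    have h3 : dist y z ≤ ‖y + smearRadius F y • v - z‖ + ‖smearRadius F y • v‖ := by
      rw [dist_eq_norm]
      calc ‖y - z‖ = ‖(y + smearRadius F y • v - z) - smearRadius F y • v‖ := by congr 1; abel
        _ ≤ _ := norm_sub_le _ _
    unfold smearRadius at *
    linarith
  rcases le_or_gt D (8 * ρ) with hcase | hcase
  · obtain ⟨x, hxF, hx⟩ := (infDist_lt_iff hF).1 (show infDist z F < 9 * ρ by linarith)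
    calc _ ≤ ∫⁻ y, (closedBall z (4 * ρ)).indicator 1 y ∂μ := by
          refine lintegral_mono fun y => ?_
          by_cases hy : y ∈ closedBall z (4 * ρ)
          · rw [Set.indicator_of_mem hy]
            exact prob_le_one
          · rw [mem_closedBall, not_le] at hy
            rw [hfar y (by linarith)]
            exact zero_le
      _ = μ (closedBall z (4 * ρ)) := by
          rw [lintegral_indicator_one measurableSet_closedBall]
      _ ≤ μ (closedBall x (20 * ρ)) := measure_mono <| closedBall_subset_closedBall' (by linarith)
      _ ≤ A * ENNReal.ofReal ((20 * ρ) ^ d) := h x hxF _ (by positivity)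
      _ = _ := by rw [mul_pow, ENNReal.ofReal_mul (by positivity), mul_assoc]
  -- Here the smearing radius is at least D/8 for relevant y, and the ball about x ∈ F has radius 2D
  -- + D/2; the product 8 · 5/2 is the 20 of the statement.
  · have hDpos : 0 < D := by linarith
    obtain ⟨x, hxF, hx⟩ := (infDist_lt_iff hF).1 (show infDist z F < 2 * D by linarith)
    calc _ ≤ ∫⁻ y, (closedBall z (D / 2)).indicator
          (fun _ => ENNReal.ofReal ((8 * ρ / D) ^ d)) y ∂μ := by
          refine lintegral_mono fun y => ?_
          by_cases hy : y ∈ closedBall z (D / 2)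
          · rw [Set.indicator_of_mem hy]
            rw [mem_closedBall, dist_comm] at hy
            have h1 : D ≤ infDist y F + dist z y := infDist_le_infDist_add_dist
            have h2 : D / 8 ≤ smearRadius F y := by
              unfold smearRadius
              linarith
            have h3 : 0 < smearRadius F y := by linarith
            refine (measure_mono fun v hv => ?_).trans ((unitBallMeasure_closedBall_le
              ((smearRadius F y)⁻¹ • (z - y)) (s := ρ / smearRadius F y) (by positivity)).trans ?_)
            · simp only [Set.mem_preimage, mem_closedBall, dist_eq_norm] at hv ⊢
              rw [le_div_iff₀ h3, mul_comm, ← Real.norm_of_nonneg h3.le, ← norm_smul,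
                Real.norm_of_nonneg h3.le, smul_sub, smul_inv_smul₀ h3.ne']
              rwa [sub_sub_eq_add_sub, add_comm]
            · gcongr ENNReal.ofReal (?_ ^ d)
              rw [div_le_div_iff₀ h3 hDpos]
              nlinarith
          · rw [mem_closedBall, not_le] at hy
            rw [hfar y (by linarith)]
            exact zero_le
      _ = ENNReal.ofReal ((8 * ρ / D) ^ d) * μ (closedBall z (D / 2)) := by
          rw [lintegral_indicator_const measurableSet_closedBall]
      _ ≤ ENNReal.ofReal ((8 * ρ / D) ^ d) * μ (closedBall x (5 * D / 2)) := by
          gcongr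
          exact closedBall_subset_closedBall' (by linarith)
      _ ≤ ENNReal.ofReal ((8 * ρ / D) ^ d) * (A * ENNReal.ofReal ((5 * D / 2) ^ d)) := by
          gcongr
          exact h x hxF _ (by positivity)
      _ = _ := by
          rw [mul_left_comm, mul_assoc, ← ENNReal.ofReal_mul (by positivity),
            ← ENNReal.ofReal_mul (by positivity), ← mul_pow, ← mul_pow]
          congr 3
          field_simp
          ring

lemma integral_smear {d : ℕ} (F : Set (Space d)) {μ : Measure (Space d)} [IsFiniteMeasure μ]
    {Φ : Space d → ℂ} (hΦ : Continuous Φ) :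
    ∫ y, Φ y ∂smear F μ =
      ∫ p, Φ (p.1 + smearRadius F p.1 • p.2) ∂μ.prod (unitBallMeasure d) :=
  integral_map (measurable_smear_map F).aemeasurable hΦ.aestronglyMeasurable

/-! ### The nontangential maximal function of the singular integral of a finite measure -/

lemma mul_div_pow_le {C r n b : ℝ} {d : ℕ} (hC : 0 ≤ C) (hr : 0 < r) (hn : 4 * r ≤ n)
    (hb : b ≤ r) : C * b / n ^ (d + 1) ≤ C * 2 ^ (d + 1) * (r / (r + n) ^ (d + 1)) := by
  have hn0 : 0 < n := by linarith
  calc C * b / n ^ (d + 1) ≤ C * r / ((r + n) / 2) ^ (d + 1) := by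
        gcongr
        linarith
    _ = _ := by
        rw [div_pow, div_div_eq_mul_div]
        ring

/-- Smearing plays the role of a Calderón–Zygmund decomposition: the smeared measure is the good
part, and the difference is estimated pointwise on F without any weak-type inequality. -/
lemma ae_exists_norm_integral_kernel_le_of_mem {d : ℕ} {K : 𝓢'(Space d, ℂ)}
    (hK : IsSingularKernelOfFundamentalType K) {ψ : 𝓢(Space d, ℂ)} (hψ : HasCompactSupport ψ)
    {μ : Measure (Space d)} [IsFiniteMeasure μ] {F : Set (Space d)} {A : ℝ≥0∞} (hA : A ≠ ⊤)
    (h : ∀ x ∈ F, ∀ r, 0 < r → μ (closedBall x r) ≤ A * ENNReal.ofReal (r ^ d)) :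
    ∀ᵐ x, x ∈ F → ∃ C : ℝ, ∀ (ε : {ε : ℝ // 0 < ε}) (x' : Space d), ‖x' - x‖ ≤ ε →
      ‖∫ y, K (dilateReflect ψ ε (x' - y)) ∂μ‖ ≤ C := by
  rcases F.eq_empty_or_nonempty with rfl | hF
  · simp
  obtain ⟨κ, B, hB, hκ⟩ := exists_hasBoundedSymbol hK.fourier_mem_Linfty
  obtain ⟨c, hc⟩ := le_smul_volume_of_ball_le (ν := smear F μ)
    (ENNReal.mul_ne_top hA ENNReal.ofReal_ne_top) fun z ρ hρ => smear_closedBall_le hF h z hρ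
  obtain ⟨C₁, hC₁, hreg⟩ := hK.exists_regularity_bound hψ
  obtain ⟨I, hI, hJI⟩ := exists_lintegral_div_pow_le d
  set J : Space d → ℝ≥0∞ := fun x => ∫⁻ y, ENNReal.ofReal
    (smearRadius F y / (smearRadius F y + ‖x - y‖) ^ (d + 1)) ∂μ with hJ
  have hmeas : Measurable fun q : Space d × Space d => ENNReal.ofReal
      (smearRadius F q.2 / (smearRadius F q.2 + ‖q.1 - q.2‖) ^ (d + 1)) := by
    have := (continuous_smearRadius F).measurable
    fun_prop
  -- Integrating in x first bounds the total integral of J by I times the mass of μ.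
  have hJfin : ∀ᵐ x, J x < ⊤ := by
    refine ae_lt_top hmeas.lintegral_prod_right' (ne_top_of_le_ne_top
      (ENNReal.mul_ne_top hI (measure_ne_top μ Set.univ)) ?_)
    rw [lintegral_lintegral_swap hmeas.aemeasurable, ← lintegral_const]
    exact lintegral_mono fun y => hJI _ y (smearRadius_nonneg F y)
  filter_upwards [ae_exists_norm_integral_kernel_le_of_le_smul_volume hK hψ hc, hJfin]
    with x ⟨C₂, hC₂⟩ hJx hxF
  refine ⟨C₂ + (ENNReal.ofReal (C₁ * 2 ^ (d + 1)) * J x).toReal, fun ε x' hx' => ?_⟩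
  set Φ : Space d → ℂ := fun y => K (dilateReflect ψ ε (x' - y)) with hΦ
  have hΦeq : Φ = reflectedSingularIntegral K (dilateReflect ψ ε x') :=
    funext fun y => (reflectedSingularIntegral_dilateReflect K ψ ε x' y).symm
  have hΦc : Continuous Φ := hΦeq ▸ hκ.continuous_reflectedSingularIntegral _
  obtain ⟨C₃, hC₃⟩ : ∃ C, ∀ y, ‖Φ y‖ ≤ C := hΦeq ▸ hκ.exists_norm_reflectedSingularIntegral_le _
  have hfst : ∫ y, Φ y ∂μ = ∫ p, Φ p.1 ∂μ.prod (unitBallMeasure d) := by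
    rw [← integral_map measurable_fst.aemeasurable hΦc.aestronglyMeasurable,
      (measurePreserving_fst (μ := μ) (ν := unitBallMeasure d)).map_eq]
  have hintegrable : ∀ T : Space d × Space d → Space d, Continuous T →
      Integrable (fun p => Φ (T p)) (μ.prod (unitBallMeasure d)) := fun T hT =>
    Integrable.of_bound (hΦc.comp hT).aestronglyMeasurable C₃ (Eventually.of_forall fun p => hC₃ _)
  have hdiff : ‖∫ y, Φ y ∂μ - ∫ y, Φ y ∂smear F μ‖ ≤
      (ENNReal.ofReal (C₁ * 2 ^ (d + 1)) * J x).toReal := by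
    rw [hfst, integral_smear F hΦc, ← integral_sub (hintegrable _ continuous_fst)
      (hintegrable _ (by fun_prop)), ← toReal_enorm]
    refine ENNReal.toReal_mono (ENNReal.mul_ne_top ENNReal.ofReal_ne_top hJx.ne) ?_
    refine (enorm_integral_le_lintegral_enorm _).trans ?_
    have hball : ∀ᵐ p ∂μ.prod (unitBallMeasure d), p.2 ∈ ball (0 : Space d) 1 :=
      (Measure.quasiMeasurePreserving_snd (μ := μ) (ν := unitBallMeasure d)).ae
        (unitBallMeasure_compl d)
    calc _ ≤ ∫⁻ p : Space d × Space d, ENNReal.ofReal (C₁ * 2 ^ (d + 1)) * ENNReal.ofReal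
            (smearRadius F p.1 / (smearRadius F p.1 + ‖x - p.1‖) ^ (d + 1))
              ∂μ.prod (unitBallMeasure d) := by
          refine lintegral_mono_ae ?_
          filter_upwards [hball] with p hp
          rw [mem_ball_zero_iff] at hp
          rw [← ENNReal.ofReal_mul (by positivity), ← ofReal_norm]
          refine ENNReal.ofReal_le_ofReal ?_
          have hr0 := smearRadius_nonneg F p.1
          -- Membership of x in F is used here: the displacement is at most a quarter of the
          -- distance from x, as the regularity bound requires.
          have hr : 4 * smearRadius F p.1 ≤ ‖x - p.1‖ := by
            have : infDist p.1 F ≤ dist p.1 x := infDist_le_dist_of_mem hxF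
            rw [dist_comm, dist_eq_norm] at this
            unfold smearRadius
            linarith
          rcases hr0.eq_or_lt with h0 | h0
          · simp [← h0]
          have hb : ‖smearRadius F p.1 • p.2‖ ≤ smearRadius F p.1 := by
            rw [norm_smul, Real.norm_of_nonneg hr0]
            exact mul_le_of_le_one_right hr0 hp.le
          have hpos : 0 < ‖x - p.1‖ := by linarith
          have := hreg ε (x - p.1) (x' - p.1) (smearRadius F p.1 • p.2) (norm_pos_iff.1 hpos)
            (by simpa using hx') (by linarith)
          rw [sub_sub] at this
          refine this.trans ?_
          exact mul_div_pow_le hC₁ h0 hr hb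
      _ = ENNReal.ofReal (C₁ * 2 ^ (d + 1)) * J x := by
          rw [lintegral_const_mul' _ _ ENNReal.ofReal_ne_top, hJ]
          congr 1
          have hm : Measurable fun y => ENNReal.ofReal
              (smearRadius F y / (smearRadius F y + ‖x - y‖) ^ (d + 1)) := by
            have := (continuous_smearRadius F).measurable
            fun_prop
          have hcomp := (measurePreserving_fst (μ := μ) (ν := unitBallMeasure d)).lintegral_comp hm
          exact hcomp
  calc ‖∫ y, Φ y ∂μ‖ = ‖∫ y, Φ y ∂smear F μ + (∫ y, Φ y ∂μ - ∫ y, Φ y ∂smear F μ)‖ := by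
        rw [add_sub_cancel]
    _ ≤ _ := (norm_add_le _ _).trans (add_le_add (hC₂ ε x' hx') hdiff)

/-- The nontangential maximal function `sup_{ε, |x' - x| ≤ ε} |(K ∗ ψ_ε ∗ μ)(x')|` of a finite
measure is finite almost everywhere. -/
lemma ae_exists_norm_integral_kernel_le {d : ℕ} {K : 𝓢'(Space d, ℂ)}
    (hK : IsSingularKernelOfFundamentalType K) {ψ : 𝓢(Space d, ℂ)} (hψ : HasCompactSupport ψ)
    (μ : Measure (Space d)) [IsFiniteMeasure μ] :
    ∀ᵐ x, ∃ C : ℝ, ∀ (ε : {ε : ℝ // 0 < ε}) (x' : Space d), ‖x' - x‖ ≤ ε →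
      ‖∫ y, K (dilateReflect ψ ε (x' - y)) ∂μ‖ ≤ C := by
  -- Integer growth constants give countably many exceptional sets, and almost every point has some
  -- finite growth constant.
  have h := fun n : ℕ => ae_exists_norm_integral_kernel_le_of_mem hK hψ (μ := μ)
    (F := {x | ∀ r, 0 < r → μ (closedBall x r) ≤ n * ENNReal.ofReal (r ^ d)})
    (ENNReal.natCast_ne_top n) fun x hx => hx
  filter_upwards [ae_all_iff.2 h, ae_hasBallGrowth_of_isFiniteMeasure μ] with x hx ⟨C, hC, hCx⟩
  obtain ⟨n, hn⟩ := ENNReal.exists_nat_gt hC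
  exact hx n fun r hr => (hCx r hr).trans (by gcongr)

/-! ### Singular integrals of signed measures -/

lemma ae_exists_norm_singularIntegralMeasure_le {d : ℕ} {K : 𝓢'(Space d, ℂ)}
    (hK : IsSingularKernelOfFundamentalType K) {ψ : 𝓢(Space d, ℂ)} (hψ : HasCompactSupport ψ)
    (g : SignedMeasure (Space d)) :
    ∀ᵐ x, ∃ C : ℝ, ∀ (ε : {ε : ℝ // 0 < ε}) (x' : Space d), ‖x' - x‖ ≤ ε →
      ‖singularIntegralMeasure K g (dilateReflect ψ ε x')‖ ≤ C := by
  filter_upwards [ae_exists_norm_integral_kernel_le hK hψ g.toJordanDecomposition.posPart,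
    ae_exists_norm_integral_kernel_le hK hψ g.toJordanDecomposition.negPart]
    with x ⟨C₁, h₁⟩ ⟨C₂, h₂⟩
  refine ⟨C₁ + C₂, fun ε x' hx' => ?_⟩
  simp only [singularIntegralMeasure, signedIntegral, reflectedSingularIntegral_dilateReflect]
  exact (norm_sub_le _ _).trans (add_le_add (h₁ ε x' hx') (h₂ ε x' hx'))

lemma singularIntegralMeasure_smul {d : ℕ} (K : 𝓢'(Space d, ℂ)) (g : SignedMeasure (Space d))
    (c : ℂ) (φ : 𝓢(Space d, ℂ)) :
    singularIntegralMeasure K g (c • φ) = c * singularIntegralMeasure K g φ := by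
  simp only [singularIntegralMeasure, signedIntegral, reflectedSingularIntegral, map_smul,
    smul_eq_mul, integral_const_mul, mul_sub]

lemma singularIntegralMeasure_add {d : ℕ} {K : 𝓢'(Space d, ℂ)}
    (hK : IsSingularKernelOfFundamentalType K) (g : SignedMeasure (Space d))
    (φ₁ φ₂ : 𝓢(Space d, ℂ)) :
    singularIntegralMeasure K g (φ₁ + φ₂) =
      singularIntegralMeasure K g φ₁ + singularIntegralMeasure K g φ₂ := by
  obtain ⟨κ, B, hB, hκ⟩ := exists_hasBoundedSymbol hK.fourier_mem_Linfty
  have hint : ∀ (ν : Measure (Space d)) [IsFiniteMeasure ν] (φ : 𝓢(Space d, ℂ)),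
      Integrable (reflectedSingularIntegral K φ) ν := fun ν _ φ => by
    obtain ⟨C, hC⟩ := hκ.exists_norm_reflectedSingularIntegral_le φ
    exact Integrable.of_bound
      (hκ.continuous_reflectedSingularIntegral φ).aestronglyMeasurable C (Eventually.of_forall hC)
  have hadd : reflectedSingularIntegral K (φ₁ + φ₂) =
      fun y => reflectedSingularIntegral K φ₁ y + reflectedSingularIntegral K φ₂ y := by
    funext y
    simp only [reflectedSingularIntegral, map_add]
  simp only [singularIntegralMeasure, signedIntegral]
  rw [hadd, integral_add (hint _ φ₁) (hint _ φ₂), integral_add (hint _ φ₁) (hint _ φ₂)]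
  ring

/-! ### The two factors of the tensor maximal function -/

/-- A real test function, as a complex Schwartz function. -/
noncomputable def testToSchwartz {d : ℕ} (a : 𝓓((⊤ : TopologicalSpace.Opens (Space d)), ℝ)) :
    𝓢(Space d, ℂ) :=
  (show HasCompactSupport (Complex.ofRealCLM ∘ a) from
    a.hasCompactSupport.comp_left rfl).toSchwartzMap (Complex.ofRealCLM.contDiff.comp a.contDiff)

@[simp]
lemma testToSchwartz_apply {d : ℕ} (a : 𝓓((⊤ : TopologicalSpace.Opens (Space d)), ℝ))
    (x : Space d) : testToSchwartz a x = a x := rfl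

lemma hasCompactSupport_testToSchwartz {d : ℕ}
    (a : 𝓓((⊤ : TopologicalSpace.Opens (Space d)), ℝ)) : HasCompactSupport (testToSchwartz a) :=
  show HasCompactSupport (Complex.ofRealCLM ∘ a) from a.hasCompactSupport.comp_left rfl

@[simp]
lemma shiftedWeight_apply {d : ℕ} (h : 𝓓((⊤ : TopologicalSpace.Opens (Space d)), ℝ)) (c : Space d)
    (p : Space d → ℝ) (hp : ContDiff ℝ ∞ p) (w : Space d) :
    shiftedWeight h c p hp w = h (c - w) * p w := rfl

lemma norm_half_smul_fst_le {n₁ n₂ : ℕ} (ξ : Metric.sphere (0 : SplitSpace n₁ n₂) 1) :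
    ‖(1 / 2 : ℝ) • (ξ : SplitSpace n₁ n₂).fst‖ ≤ 1 := by
  have h : ‖(ξ : SplitSpace n₁ n₂)‖ = 1 := by simp
  have h2 := WithLp.prod_norm_sq_eq_of_L2 (ξ : SplitSpace n₁ n₂)
  rw [h] at h2
  rw [norm_smul]
  norm_num
  nlinarith [norm_nonneg (ξ : SplitSpace n₁ n₂).fst, sq_nonneg ‖(ξ : SplitSpace n₁ n₂).snd‖]

lemma norm_half_smul_snd_le {n₁ n₂ : ℕ} (ξ : Metric.sphere (0 : SplitSpace n₁ n₂) 1) :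
    ‖(1 / 2 : ℝ) • (ξ : SplitSpace n₁ n₂).snd‖ ≤ 1 := by
  have h : ‖(ξ : SplitSpace n₁ n₂)‖ = 1 := by simp
  have h2 := WithLp.prod_norm_sq_eq_of_L2 (ξ : SplitSpace n₁ n₂)
  rw [h] at h2
  rw [norm_smul]
  norm_num
  nlinarith [norm_nonneg (ξ : SplitSpace n₁ n₂).snd, sq_nonneg ‖(ξ : SplitSpace n₁ n₂).fst‖]

/-- The parameter c is absorbed into a translation of the base point by εc, leaving two test
functions independent of c. Thus a supremum over directions becomes a nontangential supremum. -/
lemma dilateReflect_shiftedWeight {d : ℕ} (h : 𝓓((⊤ : TopologicalSpace.Opens (Space d)), ℝ))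
    (c : Space d) {p : Space d → ℝ} (hp : ContDiff ℝ ∞ p) {β : ℝ}
    (hpc : ∀ w, p w = p (w - c) + β) (ε : {ε : ℝ // 0 < ε}) (x : Space d) :
    dilateReflect (testToSchwartz (shiftedWeight h c p hp)) ε x =
      dilateReflect (testToSchwartz (shiftedWeight h 0 p hp)) ε (x - (ε : ℝ) • c) +
      (β : ℂ) • dilateReflect (testToSchwartz (shiftedWeight h 0 (fun _ => 1) contDiff_const)) ε
        (x - (ε : ℝ) • c) := by
  have hε : (0 : ℝ) < ε := ε.2
  ext y
  simp only [add_apply, smul_apply, dilateReflect_apply, testToSchwartz_apply,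
    shiftedWeight_apply, zero_sub]
  have e : (ε : ℝ)⁻¹ • (x - (ε : ℝ) • c - y) = (ε : ℝ)⁻¹ • (x - y) - c := by
    rw [sub_right_comm, smul_sub, inv_smul_smul₀ hε.ne']
  rw [e, hpc ((ε : ℝ)⁻¹ • (x - y)), neg_sub]
  simp only [Complex.real_smul, smul_eq_mul]
  push_cast
  ring

/-- Since |ξ₁/2| ≤ 1, the base point moves by at most ε, so the nontangential bounds for two fixed
test functions control all ξ with a single null set. -/
lemma ae_exists_norm_singularIntegralMeasure_upsilonOne_le {n₁ n₂ : ℕ} {K : 𝓢'(Space n₁, ℂ)}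
    (hK : IsSingularKernelOfFundamentalType K) (g : SignedMeasure (Space n₁))
    (h₁ : 𝓓((⊤ : TopologicalSpace.Opens (Space n₁)), ℝ)) (j : Fin n₁ ⊕ Fin n₂) :
    ∀ᵐ x, ∃ C : ℝ, 0 ≤ C ∧ ∀ (ξ : Metric.sphere (0 : SplitSpace n₁ n₂) 1) (ε : {ε : ℝ // 0 < ε}),
      ‖singularIntegralMeasure K g (dilateReflect (testToSchwartz (upsilonOne h₁ j ξ)) ε x)‖ ≤
        C := by
  have hβ : ∀ c : Space n₁, ‖c‖ ≤ 1 →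
      ∃ β : ℝ, ‖β‖ ≤ 1 ∧ ∀ w, coordOne j w = coordOne j (w - c) + β := fun c hc => by
    cases j with
    | inl i => exact ⟨c i, (PiLp.norm_apply_le c i).trans hc, fun w => by simp [coordOne]⟩
    | inr i => exact ⟨0, by simp, fun w => by simp [coordOne]⟩
  filter_upwards [ae_exists_norm_singularIntegralMeasure_le hK (hasCompactSupport_testToSchwartz
      (shiftedWeight h₁ 0 (coordOne j) (contDiff_coordOne j))) g,
    ae_exists_norm_singularIntegralMeasure_le hK (hasCompactSupport_testToSchwartz
      (shiftedWeight h₁ 0 (fun _ => 1) contDiff_const)) g] with x ⟨C₁, hC₁⟩ ⟨C₂, hC₂⟩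
  have hC₁0 : 0 ≤ C₁ := (norm_nonneg _).trans (hC₁ ⟨1, one_pos⟩ x (by simp))
  have hC₂0 : 0 ≤ C₂ := (norm_nonneg _).trans (hC₂ ⟨1, one_pos⟩ x (by simp))
  refine ⟨C₁ + C₂, by positivity, fun ξ ε => ?_⟩
  have hε : (0 : ℝ) < ε := ε.2
  obtain ⟨β, hβ1, hβ⟩ := hβ _ (norm_half_smul_fst_le ξ)
  set c := (1 / 2 : ℝ) • (ξ : SplitSpace n₁ n₂).fst with hc
  have hx' : ‖x - (ε : ℝ) • c - x‖ ≤ ε := by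
    rw [sub_right_comm, sub_self, zero_sub, norm_neg, norm_smul, Real.norm_of_nonneg hε.le]
    exact mul_le_of_le_one_right hε.le (norm_half_smul_fst_le ξ)
  rw [upsilonOne, dilateReflect_shiftedWeight h₁ c (contDiff_coordOne j) hβ,
    singularIntegralMeasure_add hK, singularIntegralMeasure_smul]
  refine (norm_add_le _ _).trans (add_le_add (hC₁ ε _ hx') ?_)
  rw [norm_mul, Complex.norm_real]
  calc ‖β‖ * _ ≤ 1 * C₂ := by
        gcongr
        exact hC₂ ε _ hx'
    _ = C₂ := one_mul _

/-- The factor paired with γ needs only size and support bounds uniform in ξ. The shift by ξ₂/2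
enlarges the support radius by at most 1, and the weight is at most L + 1 there. -/
lemma exists_bounds_upsilonTwo {n₁ n₂ : ℕ} (h₂ : 𝓓((⊤ : TopologicalSpace.Opens (Space n₂)), ℝ))
    (j : Fin n₁ ⊕ Fin n₂) :
    ∃ P L : ℝ, 0 ≤ P ∧ 0 ≤ L ∧ ∀ (ξ : Metric.sphere (0 : SplitSpace n₁ n₂) 1) (w : Space n₂),
      ‖testToSchwartz (upsilonTwo h₂ j ξ) w‖ ≤ P ∧
      (testToSchwartz (upsilonTwo h₂ j ξ) w ≠ 0 → ‖w‖ ≤ L) := by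
  obtain ⟨L, hL0, hL⟩ := exists_norm_le_of_hasCompactSupport h₂.hasCompactSupport
  obtain ⟨P, hP⟩ := h₂.continuous.bounded_above_of_compact_support h₂.hasCompactSupport
  have hP0 : 0 ≤ P := (norm_nonneg _).trans (hP 0)
  refine ⟨P * (L + 1), L + 1, by positivity, by positivity, fun ξ w => ?_⟩
  set c := (1 / 2 : ℝ) • (ξ : SplitSpace n₁ n₂).snd with hc
  have happ : testToSchwartz (upsilonTwo h₂ j ξ) w = ((h₂ (c - w) * coordTwo j w : ℝ) : ℂ) := rfl
  have hsupp : h₂ (c - w) ≠ 0 → ‖w‖ ≤ L + 1 := fun hw => by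
    calc ‖w‖ = ‖c - (c - w)‖ := by rw [sub_sub_cancel]
      _ ≤ ‖c‖ + ‖c - w‖ := norm_sub_le _ _
      _ ≤ L + 1 := by linarith [hL _ hw, norm_half_smul_snd_le ξ]
  rw [happ]
  by_cases h0 : h₂ (c - w) = 0
  · simp only [h0, zero_mul, Complex.ofReal_zero, norm_zero, ne_eq, not_true_eq_false,
      IsEmpty.forall_iff, and_true]
    positivity
  refine ⟨?_, fun _ => hsupp h0⟩
  rw [Complex.norm_real, norm_mul]
  gcongr
  · exact hP _
  · cases j with
    | inl i =>
      simp only [coordTwo, norm_one]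
      linarith
    | inr i => exact (PiLp.norm_apply_le w i).trans (hsupp h0)

/-! ### Finiteness of the tensor maximal function -/

lemma finrank_splitSpace (n₁ n₂ : ℕ) : Module.finrank ℝ (SplitSpace n₁ n₂) = n₁ + n₂ := by
  rw [(WithLp.linearEquiv 2 ℝ (Space n₁ × Space n₂)).finrank_eq]
  simp

lemma slice_dilateReflect_tensorTest {n₁ n₂ : ℕ}
    (a : 𝓓((⊤ : TopologicalSpace.Opens (Space n₁)), ℝ))
    (b : 𝓓((⊤ : TopologicalSpace.Opens (Space n₂)), ℝ)) (ε : {ε : ℝ // 0 < ε})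
    (x : SplitSpace n₁ n₂) (y : Space n₂) :
    slice y (dilateReflect (tensorTest a b) ε x) =
      dilateReflect (testToSchwartz b) ε x.snd y • dilateReflect (testToSchwartz a) ε x.fst := by
  ext v
  have happ : slice y (dilateReflect (tensorTest a b) ε x) v = (((ε : ℝ) ^ (n₁ + n₂))⁻¹ : ℝ) •
      ((a ((ε : ℝ)⁻¹ • (x.fst - v)) * b ((ε : ℝ)⁻¹ • (x.snd - y)) : ℝ) : ℂ) := by
    rw [← finrank_splitSpace]
    rfl
  rw [happ, smul_apply, dilateReflect_apply, dilateReflect_apply, finrank_euclideanSpace,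
    finrank_euclideanSpace, Fintype.card_fin, Fintype.card_fin, testToSchwartz_apply,
    testToSchwartz_apply]
  simp only [Complex.real_smul, smul_eq_mul, pow_add, mul_inv]
  push_cast
  ring

lemma tensorDistribution_dilateReflect_tensorTest {n₁ n₂ : ℕ} (K : 𝓢'(Space n₁, ℂ))
    (g : SignedMeasure (Space n₁)) (γ : Space n₂ → ℝ)
    (a : 𝓓((⊤ : TopologicalSpace.Opens (Space n₁)), ℝ))
    (b : 𝓓((⊤ : TopologicalSpace.Opens (Space n₂)), ℝ)) (ε : {ε : ℝ // 0 < ε})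
    (x : SplitSpace n₁ n₂) :
    tensorDistribution (singularIntegralMeasure K g) γ (dilateReflect (tensorTest a b) ε x) =
      (∫ y, dilateReflect (testToSchwartz b) ε x.snd y * γ y) *
        singularIntegralMeasure K g (dilateReflect (testToSchwartz a) ε x.fst) := by
  rw [tensorDistribution, ← integral_mul_const]
  congr 1 with y
  rw [slice_dilateReflect_tensorTest, singularIntegralMeasure_smul]
  ring

/-- The pairing is a product of a function of x₁ and a function of x₂, each bounded off a null set
of its own block; cylinders over null sets are null. -/
lemma ae_tensorMaximal_upsilon_lt_top {n₁ n₂ : ℕ} {q : ℝ≥0∞} (hq : 1 ≤ q) {K : 𝓢'(Space n₁, ℂ)}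
    (hK : IsSingularKernelOfFundamentalType K) (g : SignedMeasure (Space n₁)) {γ : Space n₂ → ℝ}
    (hγ : MemLp γ q) (h₁ : 𝓓((⊤ : TopologicalSpace.Opens (Space n₁)), ℝ))
    (h₂ : 𝓓((⊤ : TopologicalSpace.Opens (Space n₂)), ℝ)) (j : Fin n₁ ⊕ Fin n₂) :
    ∀ᵐ x, tensorMaximal (upsilonOne h₁ j) (upsilonTwo h₂ j)
      (tensorDistribution (singularIntegralMeasure K g) γ) x < ⊤ := by
  have hγ' : MemLp (fun y => (γ y : ℂ)) q := hγ.ofReal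
  obtain ⟨P, L, hP, hL, hPL⟩ := exists_bounds_upsilonTwo h₂ j
  have hofLp := (WithLp.volume_preserving_ofLp (Space n₁) (Space n₂)).quasiMeasurePreserving
  have ae₁ := (Measure.quasiMeasurePreserving_fst.comp hofLp).ae
    (ae_exists_norm_singularIntegralMeasure_upsilonOne_le hK g h₁ j)
  have ae₂ := (Measure.quasiMeasurePreserving_snd.comp hofLp).ae
    (ae_hasBallGrowth_of_memLp hq hγ')
  filter_upwards [ae₁, ae₂] with x ⟨C₁, hC₁0, hC₁⟩ hx₂
  obtain ⟨C₂, hC₂⟩ := hx₂.exists_norm_integral_le hP hL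
  refine (iSup_le fun ξ => iSup_le fun ε => ?_).trans_lt (ENNReal.ofReal_lt_top (r := C₂ * C₁))
  rw [tensorDistribution_dilateReflect_tensorTest, ← ofReal_norm, norm_mul]
  refine ENNReal.ofReal_le_ofReal (mul_le_mul ?_ (hC₁ ξ ε) (norm_nonneg _) ?_)
  · have := hC₂ ε ε.2 (testToSchwartz (upsilonTwo h₂ j ξ)) (fun w => (hPL ξ w).1)
      (fun w => (hPL ξ w).2) x.snd (by simpa using ε.2.le)
    simpa only [dilateReflect_apply, finrank_euclideanSpace, Fintype.card_fin] using this
  · have := hC₂ ε ε.2 (testToSchwartz (upsilonTwo h₂ j ξ)) (fun w => (hPL ξ w).1)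
      (fun w => (hPL ξ w).2) x.snd (by simpa using ε.2.le)
    exact (norm_nonneg _).trans this

lemma ae_splitV_lt_top {n₁ n₂ m : ℕ} {q : ℝ≥0∞} (hq : 1 ≤ q)
    {K : Fin n₁ ⊕ Fin n₂ → Fin m → 𝓢'(Space n₁, ℂ)}
    (hK : ∀ j k, IsSingularKernelOfFundamentalType (K j k))
    (g : Fin n₁ ⊕ Fin n₂ → Fin m → SignedMeasure (Space n₁))
    {γ : Fin n₁ ⊕ Fin n₂ → Fin m → Space n₂ → ℝ} (hγ : ∀ j k, MemLp (γ j k) q)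
    (h₁ : 𝓓((⊤ : TopologicalSpace.Opens (Space n₁)), ℝ))
    (h₂ : 𝓓((⊤ : TopologicalSpace.Opens (Space n₂)), ℝ)) :
    ∀ᵐ x, splitV h₁ h₂ K γ g x < ⊤ := by
  have := ae_all_iff.2 fun j => ae_all_iff.2 fun k =>
    ae_tensorMaximal_upsilon_lt_top hq (hK j k) (g j k) (hγ j k) h₁ h₂ j
  filter_upwards [this] with x hx
  exact ENNReal.sum_lt_top.2 fun j _ => ENNReal.sum_lt_top.2 fun k _ => hx j k

/-! ### Mollification along dilates -/

lemma integrable_ofReal_mul_of_hasCompactSupport {E : Type*} [NormedAddCommGroup E]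
    [MeasureSpace E] [BorelSpace E] {f : E → ℝ} (hf : LocallyIntegrable f)
    {u : E → ℂ} (hu : Continuous u) (hc : HasCompactSupport u) :
    Integrable fun z => (f z : ℂ) * u z := by
  have := hf.integrable_smul_right_of_hasCompactSupport hu hc
  simpa only [Complex.real_smul] using this

lemma integrable_ofReal_mul_fderiv {E : Type*} [NormedAddCommGroup E] [NormedSpace ℝ E]
    [MeasureSpace E] [BorelSpace E] {f : E → ℝ} (hf : LocallyIntegrable f)
    {φ : 𝓢(E, ℂ)} (hφ : HasCompactSupport φ) (e : E) :
    Integrable fun z => (f z : ℂ) * fderiv ℝ φ z e := by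
  have hcont : Continuous (fderiv ℝ φ) := (φ.smooth 1).continuous_fderiv one_ne_zero
  exact integrable_ofReal_mul_of_hasCompactSupport hf (hcont.clm_apply continuous_const)
    ((hφ.fderiv (𝕜 := ℝ)).comp_left (g := fun T : E →L[ℝ] ℂ => T e) rfl)

section Dilates

variable {E : Type*} [NormedAddCommGroup E] [NormedSpace ℝ E]

lemma hasCompactSupport_dilateReflect [ProperSpace E] {ψ : 𝓢(E, ℂ)} (hψ : HasCompactSupport ψ)
    (ε : {ε : ℝ // 0 < ε}) (x : E) : HasCompactSupport (dilateReflect ψ ε x) := by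
  obtain ⟨L, -, hL⟩ := exists_norm_le_of_hasCompactSupport hψ
  exact HasCompactSupport.of_support_subset_isCompact (isCompact_closedBall x (L * ε))
    ((subset_tsupport _).trans (tsupport_dilateReflect_subset hL ε x))

lemma fderiv_dilateReflect (ψ : 𝓢(E, ℂ)) (ε : {ε : ℝ // 0 < ε}) (x z e : E) :
    fderiv ℝ (dilateReflect ψ ε x) z e =
      -((((ε : ℝ) ^ Module.finrank ℝ E)⁻¹ * (ε : ℝ)⁻¹) •
        fderiv ℝ ψ ((ε : ℝ)⁻¹ • (x - z)) e) := by
  have h1 : HasFDerivAt (fun z : E => (ε : ℝ)⁻¹ • (x - z))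
      ((ε : ℝ)⁻¹ • (-ContinuousLinearMap.id ℝ E)) z :=
    ((hasFDerivAt_id z).const_sub x).const_smul _
  have h2 := (ψ.differentiableAt (x := (ε : ℝ)⁻¹ • (x - z))).hasFDerivAt.comp z h1
  have h3 := h2.const_smul ((((ε : ℝ) ^ Module.finrank ℝ E)⁻¹ : ℝ))
  rw [show (dilateReflect ψ ε x : E → ℂ) = fun z =>
    (((ε : ℝ) ^ Module.finrank ℝ E)⁻¹ : ℝ) • ψ ((ε : ℝ)⁻¹ • (x - z)) from rfl]
  have h4 := DFunLike.congr_fun h3.fderiv e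
  refine h4.trans ?_
  simp [mul_smul]

lemma fderiv_apply_of_eq_smul {η θ : 𝓢(E, ℂ)} {l : E →L[ℝ] ℝ} (h : ∀ w, θ w = l w • η w)
    (w e : E) : fderiv ℝ θ w e = fderiv ℝ η w (l w • e) + l e • η w := by
  have h1 := l.hasFDerivAt.smul (η.differentiableAt (x := w)).hasFDerivAt
  have h2 := h1.congr_of_eventuallyEq (f₁ := θ) (Eventually.of_forall h)
  refine (DFunLike.congr_fun h2.fderiv e).trans ?_
  simp

lemma hasDerivAt_inv_pow_smul_comp_inv_smul (ψ : 𝓢(E, ℂ)) (N : ℕ) (u : E) {s : ℝ} (hs : 0 < s) :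
    HasDerivAt (fun s : ℝ => ((s ^ N)⁻¹ : ℝ) • ψ (s⁻¹ • u))
      (-(((s ^ N)⁻¹ * s⁻¹) • ((N : ℝ) • ψ (s⁻¹ • u) + fderiv ℝ ψ (s⁻¹ • u) (s⁻¹ • u)))) s := by
  have h1 : HasDerivAt (fun s : ℝ => s⁻¹ • u) ((-(s ^ 2)⁻¹) • u) s :=
    (hasDerivAt_inv hs.ne').smul_const u
  have h2 := (ψ.differentiableAt (x := s⁻¹ • u)).hasFDerivAt.comp_hasDerivAt s h1
  have h3 : HasDerivAt (fun s : ℝ => (s ^ N)⁻¹) (-(N * ((s ^ N)⁻¹ * s⁻¹))) s := by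
    have := (hasDerivAt_pow N s).inv (pow_ne_zero N hs.ne')
    convert! this using 1
    rcases N with _ | N
    · simp
    · simp only [Nat.add_sub_cancel]
      field_simp
      ring
  have h4 := h3.smul h2
  convert! h4 using 1
  simp only [map_smul, map_neg, smul_add, smul_smul, neg_smul, smul_neg, neg_add,
    Function.comp_apply]
  rw [add_comm]
  congr 3
  · rw [pow_two, mul_inv, mul_assoc]
  · ring

variable [FiniteDimensional ℝ E] [MeasureSpace E] [BorelSpace E]

/-- The mollification `s ↦ ∫ f(z) ψ_s(x - z) dz` is differentiable in the scale `s`. -/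
lemma hasDerivAt_integral_mul_dilate {f : E → ℝ} (hf : LocallyIntegrable f) {ψ : 𝓢(E, ℂ)}
    (hψ : HasCompactSupport ψ) (x : E) (N : ℕ) {s₀ : ℝ} (hs₀ : 0 < s₀) :
    HasDerivAt (fun s : ℝ => ∫ z, (f z : ℂ) * (((s ^ N)⁻¹ : ℝ) • ψ (s⁻¹ • (x - z))))
      (∫ z, (f z : ℂ) * (-(((s₀ ^ N)⁻¹ * s₀⁻¹) • ((N : ℝ) • ψ (s₀⁻¹ • (x - z)) +
        fderiv ℝ ψ (s₀⁻¹ • (x - z)) (s₀⁻¹ • (x - z)))))) s₀ := by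
  set G : E → ℂ := fun w => (N : ℝ) • ψ w + fderiv ℝ ψ w w with hG
  have hfc : Continuous (fderiv ℝ ψ) := (ψ.smooth 1).continuous_fderiv one_ne_zero
  have hGc : Continuous G := by
    have := ψ.continuous
    fun_prop
  obtain ⟨L, hL0, hL⟩ := exists_norm_le_of_hasCompactSupport hψ
  have hGsupp : ∀ w, L < ‖w‖ → G w = 0 := fun w hw => by
    have hnt : w ∉ tsupport ψ := fun h => by
      have : tsupport ψ ⊆ closedBall 0 L := closure_minimal
        (fun v hv => mem_closedBall_zero_iff.2 (hL v hv)) isClosed_closedBall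
      have := mem_closedBall_zero_iff.1 (this h)
      linarith
    simp only [hG]
    rw [image_eq_zero_of_notMem_tsupport hnt,
      image_eq_zero_of_notMem_tsupport fun h => hnt (tsupport_fderiv_subset ℝ h)]
    simp
  have hGcs : HasCompactSupport G := HasCompactSupport.intro (isCompact_closedBall (0 : E) L)
    fun w hw => hGsupp w (by simpa using hw)
  obtain ⟨C, hC⟩ := hGc.bounded_above_of_compact_support hGcs
  have hC0 : 0 ≤ C := (norm_nonneg _).trans (hC 0)
  have hψs : ∀ s : ℝ, 0 < s → Integrable fun z =>
      (f z : ℂ) * (((s ^ N)⁻¹ : ℝ) • ψ (s⁻¹ • (x - z))) := fun s hs => by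
    refine integrable_ofReal_mul_of_hasCompactSupport hf (by have := ψ.continuous; fun_prop) ?_
    refine HasCompactSupport.intro (isCompact_closedBall x (L * s)) fun z hz => ?_
    by_contra hne
    have h0 : ψ (s⁻¹ • (x - z)) ≠ 0 := fun h => hne (by rw [h, smul_zero])
    have := hL _ h0
    rw [norm_smul, Real.norm_of_nonneg (inv_nonneg.2 hs.le), inv_mul_le_iff₀ hs] at this
    rw [mem_closedBall, not_le, dist_comm, dist_eq_norm] at hz
    linarith
  have hfm : AEStronglyMeasurable (fun z => (f z : ℂ)) :=
    Complex.continuous_ofReal.comp_aestronglyMeasurable hf.aestronglyMeasurable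
  have hball : ∀ s ∈ ball s₀ (s₀ / 2), s₀ / 2 < s ∧ s < 2 * s₀ := fun s hs => by
    rw [mem_ball, Real.dist_eq, abs_lt] at hs
    constructor <;> linarith
  -- For s between s₀/2 and 2s₀ every integrand vanishes off one fixed ball, and the negative powers
  -- of s are largest at s₀/2.
  refine (hasDerivAt_integral_of_dominated_loc_of_deriv_le (ball_mem_nhds s₀ (half_pos hs₀))
    (bound := (closedBall x (2 * L * s₀)).indicator fun z =>
      ((((s₀ / 2) ^ N)⁻¹ * (s₀ / 2)⁻¹) * C) * ‖f z‖)
    (F' := fun s z => (f z : ℂ) * (-(((s ^ N)⁻¹ * s⁻¹) • G (s⁻¹ • (x - z)))))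
    ?_ (hψs s₀ hs₀) ?_ ?_ ?_ ?_).2
  · filter_upwards [lt_mem_nhds hs₀] with s hs
    exact (hψs s hs).1
  · exact hfm.mul (Continuous.aestronglyMeasurable (by fun_prop))
  · refine Eventually.of_forall fun z s hs => ?_
    obtain ⟨h1, h2⟩ := hball s hs
    have hs0 : 0 < s := by linarith
    by_cases hz : z ∈ closedBall x (2 * L * s₀)
    · rw [Set.indicator_of_mem hz, norm_mul, norm_neg, norm_smul, Complex.norm_real,
        Real.norm_of_nonneg (r := (s ^ N)⁻¹ * s⁻¹) (by positivity), mul_comm]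
      gcongr
      exact hC _
    · rw [hGsupp, smul_zero, neg_zero, mul_zero, norm_zero]
      · exact Set.indicator_nonneg (fun z _ => by positivity) z
      · rw [mem_closedBall, not_le, dist_comm, dist_eq_norm] at hz
        rw [norm_smul, Real.norm_of_nonneg (inv_nonneg.2 hs0.le), lt_inv_mul_iff₀ hs0]
        nlinarith
  · rw [integrable_indicator_iff measurableSet_closedBall]
    exact ((hf.integrableOn_isCompact (isCompact_closedBall _ _)).norm).const_mul _
  · refine Eventually.of_forall fun z s hs => ?_
    have hs0 : 0 < s := by linarith [hball s hs]
    exact (hasDerivAt_inv_pow_smul_comp_inv_smul ψ N (x - z) hs0).const_mul _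

variable [(volume : Measure E).IsAddHaarMeasure]

lemma integral_dilateReflect (ψ : 𝓢(E, ℂ)) (ε : {ε : ℝ // 0 < ε}) (x : E) :
    ∫ z, dilateReflect ψ ε x z = ∫ z, ψ z := by
  have hε : (0 : ℝ) < ε := ε.2
  simp only [dilateReflect_apply]
  rw [integral_sub_left_eq_self (fun z =>
    (((ε : ℝ) ^ Module.finrank ℝ E)⁻¹ : ℝ) • ψ ((ε : ℝ)⁻¹ • z)), integral_smul,
    Measure.integral_comp_inv_smul_of_nonneg volume ψ hε.le, inv_smul_smul₀ (by positivity)]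

/-- Mollifications converge at Lebesgue points. -/
lemma tendsto_integral_mul_dilate {f : E → ℝ} (hf : LocallyIntegrable f) {ψ : 𝓢(E, ℂ)}
    (hψ : HasCompactSupport ψ) (hψ1 : ∫ z, ψ z = 1) {x : E}
    (hx : Tendsto (fun r => ⨍ y in closedBall x r, ‖f y - f x‖) (𝓝[>] 0) (𝓝 0)) :
    Tendsto (fun s : ℝ => ∫ z, (f z : ℂ) *
      (((s ^ Module.finrank ℝ E)⁻¹ : ℝ) • ψ (s⁻¹ • (x - z)))) (𝓝[>] 0) (𝓝 (f x)) := by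
  obtain ⟨L', hL0', hL'⟩ := exists_norm_le_of_hasCompactSupport hψ
  obtain ⟨L, hL0, hL⟩ : ∃ L, 0 < L ∧ ∀ v, ψ v ≠ 0 → ‖v‖ ≤ L :=
    ⟨L' + 1, by positivity, fun v hv => (hL' v hv).trans (by linarith)⟩
  obtain ⟨P, hP⟩ := ψ.continuous.bounded_above_of_compact_support hψ
  have hP0 : 0 ≤ P := (norm_nonneg _).trans (hP 0)
  set N := Module.finrank ℝ E with hN
  set v := volume.real (ball (0 : E) 1) with hv
  have hscale : Tendsto (fun s : ℝ => L * s) (𝓝[>] 0) (𝓝[>] 0) := by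
    refine tendsto_nhdsWithin_iff.2 ⟨?_, ?_⟩
    · have : Tendsto (fun s : ℝ => L * s) (𝓝 0) (𝓝 (L * 0)) := (continuous_const_mul L).tendsto 0
      rw [mul_zero] at this
      exact this.mono_left nhdsWithin_le_nhds
    · filter_upwards [self_mem_nhdsWithin] with s hs
      exact mul_pos hL0 hs
  -- The constant is the sup bound s^{-N} P of the mollifier times the volume of the ball of radius
  -- Ls.
  have hlim := (hx.comp hscale).const_mul (P * L ^ N * v)
  rw [mul_zero] at hlim
  rw [tendsto_iff_norm_sub_tendsto_zero]
  refine squeeze_zero' (Eventually.of_forall fun _ => norm_nonneg _) ?_ hlim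
  filter_upwards [self_mem_nhdsWithin] with s hs
  rw [Set.mem_Ioi] at hs
  set φ := dilateReflect ψ ⟨s, hs⟩ x with hφ
  have hφc := hasCompactSupport_dilateReflect hψ ⟨s, hs⟩ x
  have e1 : (f x : ℂ) = ∫ z, (f x : ℂ) * φ z := by
    rw [integral_const_mul, integral_dilateReflect, hψ1, mul_one]
  have i1 : Integrable fun z => (f z : ℂ) * φ z :=
    integrable_ofReal_mul_of_hasCompactSupport hf φ.continuous hφc
  have e2 : (∫ z, (f z : ℂ) * (((s ^ N)⁻¹ : ℝ) • ψ (s⁻¹ • (x - z)))) - (f x : ℂ) =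
      ∫ z, ((f z : ℂ) - f x) * φ z := by
    conv_lhs => rw [e1]
    simp only [sub_mul]
    rw [integral_sub i1 (φ.integrable.const_mul _)]
    rfl
  rw [e2]
  have hvol : volume.real (closedBall x (L * s)) = (L * s) ^ N * v := by
    rw [Measure.real, Measure.addHaar_closedBall _ _ (by positivity), ENNReal.toReal_mul,
      ENNReal.toReal_ofReal (by positivity)]
    rfl
  have hv0 : 0 < v := ENNReal.toReal_pos (measure_ball_pos _ _ one_pos).ne' measure_ball_lt_top.ne
  have hint : Integrable ((closedBall x (L * s)).indicator fun z =>
      ((s ^ N)⁻¹ * P) * ‖f z - f x‖) := by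
    rw [integrable_indicator_iff measurableSet_closedBall]
    refine Integrable.const_mul (Integrable.norm ?_) _
    exact (hf.integrableOn_isCompact (isCompact_closedBall _ _)).sub
      (integrableOn_const measure_closedBall_lt_top.ne)
  refine (norm_integral_le_of_norm_le hint (Eventually.of_forall fun z => ?_)).trans_eq ?_
  · by_cases h0 : φ z = 0
    · rw [h0, mul_zero, norm_zero]
      exact Set.indicator_nonneg (fun z _ => by positivity) z
    · have hz : z ∈ closedBall x (L * s) :=
        tsupport_dilateReflect_subset hL ⟨s, hs⟩ x (subset_tsupport _ h0)
      rw [Set.indicator_of_mem hz, norm_mul, mul_comm, ← Complex.ofReal_sub, Complex.norm_real]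
      gcongr
      rw [hφ, dilateReflect_apply, norm_smul, Real.norm_of_nonneg (by positivity)]
      gcongr
      exact hP _
  · rw [integral_indicator measurableSet_closedBall, integral_const_mul, Function.comp_apply,
      setAverage_eq, hvol, smul_eq_mul, mul_pow]
    field_simp

end Dilates

/-! ### The pointwise estimate -/

/-- The coordinate functionals of `ℝ^{n₁} × ℝ^{n₂}`. -/
noncomputable def coordCLM {n₁ n₂ : ℕ} : Fin n₁ ⊕ Fin n₂ → SplitSpace n₁ n₂ →L[ℝ] ℝ
  | Sum.inl i => (EuclideanSpace.proj i).comp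
    ((ContinuousLinearMap.fst ℝ (Space n₁) (Space n₂)).comp
      (WithLp.prodContinuousLinearEquiv 2 ℝ (Space n₁) (Space n₂) :
        SplitSpace n₁ n₂ →L[ℝ] Space n₁ × Space n₂))
  | Sum.inr i => (EuclideanSpace.proj i).comp
    ((ContinuousLinearMap.snd ℝ (Space n₁) (Space n₂)).comp
      (WithLp.prodContinuousLinearEquiv 2 ℝ (Space n₁) (Space n₂) :
        SplitSpace n₁ n₂ →L[ℝ] Space n₁ × Space n₂))

lemma coordCLM_eq {n₁ n₂ : ℕ} (j : Fin n₁ ⊕ Fin n₂) (w : SplitSpace n₁ n₂) :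
    coordCLM j w = coordOne j w.fst * coordTwo j w.snd := by
  cases j <;> simp [coordCLM, coordOne, coordTwo]

lemma coordCLM_stdBasis {n₁ n₂ : ℕ} (j : Fin n₁ ⊕ Fin n₂) : coordCLM j (stdBasis j) = 1 := by
  cases j <;> simp [coordCLM, stdBasis]

lemma sum_coordCLM_smul_stdBasis {n₁ n₂ : ℕ} (w : SplitSpace n₁ n₂) :
    ∑ j, coordCLM j w • stdBasis j = w := by
  apply (WithLp.prodContinuousLinearEquiv 2 ℝ (Space n₁) (Space n₂)).injective
  rw [map_sum]
  ext i
  · simp [Fintype.sum_sum_type, coordCLM, stdBasis, Prod.fst_sum, Pi.single_apply]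
  · simp [Fintype.sum_sum_type, coordCLM, stdBasis, Prod.snd_sum, Pi.single_apply]

lemma hasCompactSupport_tensorTest {n₁ n₂ : ℕ}
    (a : 𝓓((⊤ : TopologicalSpace.Opens (Space n₁)), ℝ))
    (b : 𝓓((⊤ : TopologicalSpace.Opens (Space n₂)), ℝ)) : HasCompactSupport (tensorTest a b) :=
  hasCompactSupport_tensor a b

/-- The function `w ↦ h₁(ξ₁/2 - w₁) h₂(ξ₂/2 - w₂)`. -/
noncomputable def shiftedTensor {n₁ n₂ : ℕ} (h₁ : 𝓓((⊤ : TopologicalSpace.Opens (Space n₁)), ℝ))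
    (h₂ : 𝓓((⊤ : TopologicalSpace.Opens (Space n₂)), ℝ)) (ξ : SplitSpace n₁ n₂) :
    𝓢(SplitSpace n₁ n₂, ℂ) :=
  tensorTest (shiftedWeight h₁ ((1 / 2 : ℝ) • ξ.fst) (fun _ => 1) contDiff_const)
    (shiftedWeight h₂ ((1 / 2 : ℝ) • ξ.snd) (fun _ => 1) contDiff_const)

section Pointwise

variable {n₁ n₂ : ℕ} (h₁ : 𝓓((⊤ : TopologicalSpace.Opens (Space n₁)), ℝ))
  (h₂ : 𝓓((⊤ : TopologicalSpace.Opens (Space n₂)), ℝ))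

lemma shiftedTensor_apply (ξ w : SplitSpace n₁ n₂) :
    shiftedTensor h₁ h₂ ξ w =
      ((h₁ ((1 / 2 : ℝ) • ξ.fst - w.fst) * h₂ ((1 / 2 : ℝ) • ξ.snd - w.snd) : ℝ) : ℂ) := by
  have : shiftedTensor h₁ h₂ ξ w = ((h₁ ((1 / 2 : ℝ) • ξ.fst - w.fst) * 1 *
    (h₂ ((1 / 2 : ℝ) • ξ.snd - w.snd) * 1) : ℝ) : ℂ) := rfl
  rw [this, mul_one, mul_one]

lemma integral_shiftedTensor (hh₁ : ∫ x, h₁ x = 1) (hh₂ : ∫ x, h₂ x = 1) (ξ : SplitSpace n₁ n₂) :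
    ∫ w, shiftedTensor h₁ h₂ ξ w = 1 := by
  simp only [shiftedTensor_apply]
  rw [integral_complex_ofReal]
  have hmp := WithLp.volume_preserving_symm_measurableEquiv_toLp_prod (Space n₁) (Space n₂)
  have := hmp.integral_comp' (fun p : Space n₁ × Space n₂ =>
    h₁ ((1 / 2 : ℝ) • ξ.fst - p.1) * h₂ ((1 / 2 : ℝ) • ξ.snd - p.2))
  rw [Measure.volume_eq_prod, integral_prod_mul (fun v => h₁ ((1 / 2 : ℝ) • ξ.fst - v))
    (fun v => h₂ ((1 / 2 : ℝ) • ξ.snd - v)), integral_sub_left_eq_self (fun v => h₁ v),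
    integral_sub_left_eq_self (fun v => h₂ v), hh₁, hh₂, one_mul] at this
  exact_mod_cast this

lemma hasCompactSupport_shiftedTensor (ξ : SplitSpace n₁ n₂) :
    HasCompactSupport (shiftedTensor h₁ h₂ ξ) :=
  hasCompactSupport_tensorTest _ _

lemma tensorTest_upsilon_apply (j : Fin n₁ ⊕ Fin n₂)
    (ξ : Metric.sphere (0 : SplitSpace n₁ n₂) 1) (w : SplitSpace n₁ n₂) :
    tensorTest (upsilonOne h₁ j ξ) (upsilonTwo h₂ j ξ) w =
      coordCLM j w • shiftedTensor h₁ h₂ ξ w := by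
  have : tensorTest (upsilonOne h₁ j ξ) (upsilonTwo h₂ j ξ) w =
    ((h₁ ((1 / 2 : ℝ) • (ξ : SplitSpace n₁ n₂).fst - w.fst) * coordOne j w.fst *
      (h₂ ((1 / 2 : ℝ) • (ξ : SplitSpace n₁ n₂).snd - w.snd) * coordTwo j w.snd) : ℝ) : ℂ) := rfl
  rw [this, shiftedTensor_apply, coordCLM_eq, Complex.real_smul]
  push_cast
  ring

/-- This is div(wη) = Nη + w·∇η, the expression that also arises on differentiating s^{-N} η(·/s) in
s. -/
lemma sum_fderiv_tensorTest_upsilon (ξ : Metric.sphere (0 : SplitSpace n₁ n₂) 1)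
    (w : SplitSpace n₁ n₂) :
    ∑ j, fderiv ℝ (tensorTest (upsilonOne h₁ j ξ) (upsilonTwo h₂ j ξ)) w (stdBasis j) =
      ((n₁ + n₂ : ℕ) : ℝ) • shiftedTensor h₁ h₂ ξ w + fderiv ℝ (shiftedTensor h₁ h₂ ξ) w w := by
  have hd : ∀ j : Fin n₁ ⊕ Fin n₂,
      fderiv ℝ (tensorTest (upsilonOne h₁ j ξ) (upsilonTwo h₂ j ξ)) w (stdBasis j) =
        fderiv ℝ (shiftedTensor h₁ h₂ ξ) w (coordCLM j w • stdBasis j) +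
          shiftedTensor h₁ h₂ ξ w := fun j => by
    rw [fderiv_apply_of_eq_smul (tensorTest_upsilon_apply h₁ h₂ j ξ), coordCLM_stdBasis, one_smul]
  simp only [hd, Finset.sum_add_distrib]
  rw [← map_sum, sum_coordCLM_smul_stdBasis, add_comm]
  simp

variable {m : ℕ} {f : SplitSpace n₁ n₂ → ℝ} {K : Fin n₁ ⊕ Fin n₂ → Fin m → 𝓢'(Space n₁, ℂ)}
  {g : Fin n₁ ⊕ Fin n₂ → Fin m → SignedMeasure (Space n₁)}
  {γ : Fin n₁ ⊕ Fin n₂ → Fin m → Space n₂ → ℝ}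

/-- Integration by parts turns each summand into ∂_j f tested on one competitor (ξ, ε) in the
suprema defining V. -/
lemma norm_integral_sum_fderiv_le_splitV (hf : LocallyIntegrable f)
    (hderiv : ∀ j, HasDistribPartialDeriv f j
      (fun φ => ∑ k, tensorDistribution (singularIntegralMeasure (K j k) (g j k)) (γ j k) φ))
    (ξ : Metric.sphere (0 : SplitSpace n₁ n₂) 1) (ε : {ε : ℝ // 0 < ε}) (x : SplitSpace n₁ n₂)
    (hx : splitV h₁ h₂ K γ g x < ⊤) :
    ‖∫ z, (f z : ℂ) * ∑ j, fderiv ℝ (dilateReflect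
      (tensorTest (upsilonOne h₁ j ξ) (upsilonTwo h₂ j ξ)) ε x) z (stdBasis j)‖ ≤
        (splitV h₁ h₂ K γ g x).toReal := by
  set φ : Fin n₁ ⊕ Fin n₂ → 𝓢(SplitSpace n₁ n₂, ℂ) := fun j =>
    dilateReflect (tensorTest (upsilonOne h₁ j ξ) (upsilonTwo h₂ j ξ)) ε x with hφ
  have hc : ∀ j, HasCompactSupport (φ j) := fun j =>
    hasCompactSupport_dilateReflect (hasCompactSupport_tensorTest _ _) ε x
  have hint : ∀ j, Integrable fun z => (f z : ℂ) * fderiv ℝ (φ j) z (stdBasis j) := fun j =>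
    integrable_ofReal_mul_fderiv hf (hc j) _
  rw [← toReal_enorm]
  refine ENNReal.toReal_mono hx.ne ?_
  simp only [Finset.mul_sum]
  rw [integral_finsetSum _ fun j _ => hint j]
  refine (enorm_sum_le _ _).trans (Finset.sum_le_sum fun j _ => ?_)
  rw [← enorm_neg, hderiv j (φ j) (hc j)]
  refine (enorm_sum_le _ _).trans (Finset.sum_le_sum fun k _ => ?_)
  exact le_iSup_of_le ξ (le_iSup_of_le ε le_rfl)

/-- At a Lebesgue point, `f` differs from its mollification at scale `r` by at most `r V(x)`. -/
lemma norm_integral_dilate_sub_le (hf : LocallyIntegrable f)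
    (hderiv : ∀ j, HasDistribPartialDeriv f j
      (fun φ => ∑ k, tensorDistribution (singularIntegralMeasure (K j k) (g j k)) (γ j k) φ))
    (hh₁ : ∫ x, h₁ x = 1) (hh₂ : ∫ x, h₂ x = 1)
    (ξ : Metric.sphere (0 : SplitSpace n₁ n₂) 1) {x : SplitSpace n₁ n₂}
    (hx : splitV h₁ h₂ K γ g x < ⊤)
    (hleb : Tendsto (fun r => ⨍ y in closedBall x r, ‖f y - f x‖) (𝓝[>] 0) (𝓝 0))
    {r : ℝ} (hr : 0 < r) :
    ‖(∫ z, (f z : ℂ) * (((r ^ (n₁ + n₂))⁻¹ : ℝ) • shiftedTensor h₁ h₂ ξ (r⁻¹ • (x - z)))) - f x‖ ≤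
      (splitV h₁ h₂ K γ g x).toReal * r := by
  set V := (splitV h₁ h₂ K γ g x).toReal with hV
  set Fs : ℝ → ℂ := fun s => ∫ z, (f z : ℂ) *
    (((s ^ (n₁ + n₂))⁻¹ : ℝ) • shiftedTensor h₁ h₂ ξ (s⁻¹ • (x - z))) with hFs
  have hη := hasCompactSupport_shiftedTensor h₁ h₂ (ξ : SplitSpace n₁ n₂)
  have hlim : Tendsto Fs (𝓝[>] 0) (𝓝 (f x)) := by
    have := tendsto_integral_mul_dilate hf hη (integral_shiftedTensor h₁ h₂ hh₁ hh₂ ξ) hleb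
    rwa [finrank_splitSpace] at this
  have hmv : ∀ s ∈ Set.Ioi (0 : ℝ), ‖Fs r - Fs s‖ ≤ V * ‖r - s‖ := fun s hs => by
    refine (convex_Ioi (0 : ℝ)).norm_image_sub_le_of_norm_hasDerivWithin_le
      (fun t ht => (hasDerivAt_integral_mul_dilate hf hη x (n₁ + n₂) ht).hasDerivWithinAt)
      (fun t ht => ?_) hs hr
    replace ht : 0 < t := ht
    -- The minus sign of the scale derivative matches the one from differentiating z ↦ (x - z)/t.
    refine le_of_eq_of_le ?_
      (norm_integral_sum_fderiv_le_splitV h₁ h₂ hf hderiv ξ ⟨t, ht⟩ x hx)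
    congr 2 with z
    simp only [fderiv_dilateReflect, finrank_splitSpace]
    rw [Finset.sum_neg_distrib, ← Finset.smul_sum, sum_fderiv_tensorTest_upsilon]
  -- The mean value bound holds on (0, ∞) only; the endpoint value f(x) is reached by letting s → 0.
  refine le_of_tendsto (tendsto_const_nhds.sub hlim).norm ?_
  filter_upwards [Ioo_mem_nhdsGT hr] with s hs
  refine (hmv s hs.1).trans ?_
  gcongr
  rw [Real.norm_of_nonneg (by linarith [hs.2])]
  linarith [hs.1]

/-- Both arguments reduce to r⁻¹(z - (x + y)/2); the factor 1/2 in the shift is chosen for this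
symmetry. -/
lemma shiftedTensor_symm {x y : SplitSpace n₁ n₂} {r : ℝ} (z : SplitSpace n₁ n₂) :
    shiftedTensor h₁ h₂ (r⁻¹ • (x - y)) (r⁻¹ • (x - z)) =
      shiftedTensor h₁ h₂ (r⁻¹ • (y - x)) (r⁻¹ • (y - z)) := by
  rw [shiftedTensor_apply, shiftedTensor_apply]
  have e₁ : (1 / 2 : ℝ) • (r⁻¹ • (x - y)).fst - (r⁻¹ • (x - z)).fst =
      (1 / 2 : ℝ) • (r⁻¹ • (y - x)).fst - (r⁻¹ • (y - z)).fst := by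
    simp only [WithLp.smul_fst, WithLp.sub_fst]
    module
  have e₂ : (1 / 2 : ℝ) • (r⁻¹ • (x - y)).snd - (r⁻¹ • (x - z)).snd =
      (1 / 2 : ℝ) • (r⁻¹ • (y - x)).snd - (r⁻¹ • (y - z)).snd := by
    simp only [WithLp.smul_snd, WithLp.sub_snd]
    module
  rw [e₁, e₂]

end Pointwise

theorem lemma5p2 (n₁ n₂ m : ℕ) (q : ℝ≥0∞) (hq : 1 < q)
    (f : SplitSpace n₁ n₂ → ℝ) (hf : LocallyIntegrable f)
    (K : Fin n₁ ⊕ Fin n₂ → Fin m → 𝓢'(Space n₁, ℂ))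
    (hK : ∀ j k, IsSingularKernelOfFundamentalType (K j k))
    (g : Fin n₁ ⊕ Fin n₂ → Fin m → SignedMeasure (Space n₁))
    (γ : Fin n₁ ⊕ Fin n₂ → Fin m → Space n₂ → ℝ)
    (hγ : ∀ j k, MemLp (γ j k) q)
    (hderiv : ∀ j, HasDistribPartialDeriv f j
      (fun φ => ∑ k, tensorDistribution (singularIntegralMeasure (K j k) (g j k)) (γ j k) φ))
    (h₁ : 𝓓((⊤ : TopologicalSpace.Opens (Space n₁)), ℝ)) (hh₁ : ∫ x, h₁ x = 1)
    (h₂ : 𝓓((⊤ : TopologicalSpace.Opens (Space n₂)), ℝ)) (hh₂ : ∫ x, h₂ x = 1) :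
    ∃ V : SplitSpace n₁ n₂ → ℝ, (∀ x, 0 ≤ V x) ∧
      ∃ 𝒩 : Set (SplitSpace n₁ n₂), volume 𝒩 = 0 ∧
        (∀ x, x ∉ 𝒩 → splitV h₁ h₂ K γ g x = ENNReal.ofReal (V x)) ∧
        (∀ x y, x ∉ 𝒩 → y ∉ 𝒩 → |f x - f y| ≤ ‖x - y‖ * (V x + V y)) := by
  set V : SplitSpace n₁ n₂ → ℝ := fun x => (splitV h₁ h₂ K γ g x).toReal with hV
  have hfin := ae_splitV_lt_top hq.le hK g hγ h₁ h₂
  have hleb : ∀ᵐ x, Tendsto (fun r => ⨍ y in closedBall x r, ‖f y - f x‖) (𝓝[>] 0) (𝓝 0) := by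
    filter_upwards [(Besicovitch.vitaliFamily (volume : Measure (SplitSpace n₁ n₂))
      ).ae_tendsto_average_norm_sub hf] with x hx
    exact hx.comp (Besicovitch.tendsto_filterAt volume x)
  refine ⟨V, fun x => ENNReal.toReal_nonneg, _, hfin.and hleb, fun x hx => ?_, fun x y hx hy => ?_⟩
  · rw [Set.notMem_compl_iff] at hx
    exact (ENNReal.ofReal_toReal hx.1.ne).symm
  rw [Set.notMem_compl_iff] at hx hy
  rcases eq_or_ne x y with rfl | hxy
  · simp
  set r := ‖x - y‖ with hr
  have hr0 : 0 < r := norm_pos_iff.2 (sub_ne_zero.2 hxy)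
  have hsphere : ∀ v : SplitSpace n₁ n₂, ‖v‖ = r → r⁻¹ • v ∈ Metric.sphere 0 1 := fun v hv => by
    rw [mem_sphere_zero_iff_norm, norm_smul, hv, Real.norm_of_nonneg (inv_nonneg.2 hr0.le),
      inv_mul_cancel₀ hr0.ne']
  have ex := norm_integral_dilate_sub_le h₁ h₂ hf hderiv hh₁ hh₂ ⟨_, hsphere (x - y) rfl⟩
    hx.1 hx.2 hr0
  have ey := norm_integral_dilate_sub_le h₁ h₂ hf hderiv hh₁ hh₂
    ⟨_, hsphere (y - x) (norm_sub_rev y x)⟩ hy.1 hy.2 hr0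
  -- Both estimates now refer to the same midpoint average A.
  simp only [shiftedTensor_symm h₁ h₂ (x := x) (y := y)] at ex
  set A := ∫ z, (f z : ℂ) * (((r ^ (n₁ + n₂))⁻¹ : ℝ) •
    shiftedTensor h₁ h₂ (r⁻¹ • (y - x)) (r⁻¹ • (y - z)))
  calc |f x - f y| = ‖((f x : ℂ) - f y)‖ := by
        rw [← Complex.ofReal_sub, Complex.norm_real, Real.norm_eq_abs]
    _ = ‖(A - f y) - (A - f x)‖ := by rw [sub_sub_sub_cancel_left]
    _ ≤ V y * r + V x * r := (norm_sub_le _ _).trans (add_le_add ey ex)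
    _ = r * (V x + V y) := by ring
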